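/- Let $F$ be a free group of finite rank at least $2$, and let $\phi : F \to F$ be an injective endomorphism that is represented by a clean map. Let $H \le F$ be a finitely generated subgroup such that $\phi(H) \le H$ and such that some element of $H$ has a $\phi$-expanding conjugacy class. Then \[ [\phi^k(F) : \phi^k(F) \cap H] < \infty \quad \text{for some } k \ge 0 . \] Here the terms are used as follows. Fix a basis of $F$. A conjugacy class $c$ of $F$ is \emph{$\phi$-expanding} if the lengths of the classes $\phi^k(c)$, $k \ge 0$, are unbounded, where the length of a conjugacy class is the minimal word length of its elements. Let $\Gamma$ be a connected finite core graph, i.e. a connected finite $1$-dimensional CW-complex without univalent vertices. A map $f : \Gamma \to \Gamma$ that sends vertices to vertices and edges to edge paths is a \emph{train track} if all iterates $f^k$, $k \ge 1$, are locally injective in the interior of edges and at bivalent vertices. It is \emph{irreducible} if for any two edges $e, e'$ the edge $e'$ lies in $f^k(e)$ for some $k \ge 1$. The \emph{Whitehead graph} of $f$ at a vertex $v$ has the half-edges at $v$ as its vertices, and two distinct half-edges are joined by an edge if the turn they form is taken by the path $f^k(e)$ for some edge $e$ and some $k$. The map $f$ is \emph{clean} if it is an irreducible train track, its Whitehead graph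 at every vertex is connected, and some iterate $f^k$, $k \ge 1$, maps every edge onto the whole graph $\Gamma$. The map $f$ \emph{represents} $\phi$ if it is locally injective in the interior of edges and at bivalent vertices and there is an isomorphism $\alpha : F \to \pi_1(\Gamma)$ such that $f_* \circ \alpha$ and $\alpha \circ \phi$ agree up to an inner automorphism of $\pi_1(\Gamma)$. -/

import Mathlib

/-! ### Finite graphs, edge paths and the fundamental group

A graph (one-dimensional CW-complex) is presented by its vertices `V`, its oriented edges `E`
(two for every geometric edge), the initial vertex of an oriented edge and the
fixed-point-free involution that reverses orientation.  The oriented edges that start at a vertex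
are the half-edges attached to that vertex. -/

/-- A graph with vertex set `V` and set of oriented edges `E`. -/
structure OrientedGraph (V E : Type*) where
  /-- initial vertex of an oriented edge -/
  src : E → V
  /-- the same edge with the opposite orientation -/
  rev : E → E
  rev_rev : ∀ e, rev (rev e) = e
  rev_ne : ∀ e, rev e ≠ e

namespace OrientedGraph

section Paths

variable {V E : Type*} (Γ : OrientedGraph V E)

/-- Terminal vertex of an oriented edge. -/
def tgt (e : E) : V := Γ.src (Γ.rev e)

/-- `Γ.IsPath u p v`: the list `p` of oriented edges is an edge path from `u` to `v`. -/
def IsPath : V → List E → V → Prop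
  | u, [], v => u = v
  | u, e :: p, v => Γ.src e = u ∧ IsPath (Γ.tgt e) p v

/-- The edge path `p` traversed backwards. -/
def revPath (p : List E) : List E := (p.map Γ.rev).reverse

/-- An edge path is reduced (an immersed path) if it does not backtrack. -/
def IsReduced (p : List E) : Prop := p.IsChain (fun e e' => e' ≠ Γ.rev e)

/-- Number of half-edges at a vertex (a loop counts twice). -/
noncomputable def valence (v : V) : ℕ := Nat.card {e : E // Γ.src e = v}

/-- Any two vertices are joined by an edge path. -/
def IsConnected : Prop := ∀ u v, ∃ p, Γ.IsPath u p v

/-- No univalent vertices. -/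
def IsCore : Prop := ∀ v, Γ.valence v ≠ 1

theorem IsPath.append {u v w : V} {p q : List E} (hp : Γ.IsPath u p v) (hq : Γ.IsPath v q w) :
    Γ.IsPath u (p ++ q) w := by
  induction p generalizing u with
  | nil => cases hp; exact hq
  | cons e p ih => exact ⟨hp.1, ih hp.2⟩

theorem IsPath.rev {u v : V} {p : List E} (hp : Γ.IsPath u p v) :
    Γ.IsPath v (Γ.revPath p) u := by
  induction p generalizing u with
  | nil => exact Eq.symm hp
  | cons e p ih =>
    have h : Γ.revPath (e :: p) = Γ.revPath p ++ [Γ.rev e] := by simp [revPath]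
    rw [h]
    refine IsPath.append Γ (ih hp.2) ⟨rfl, ?_⟩
    change Γ.src (Γ.rev (Γ.rev e)) = u
    rw [Γ.rev_rev]
    exact hp.1

theorem IsPath.of_append {u w : V} {p q : List E} (h : Γ.IsPath u (p ++ q) w) :
    ∃ v, Γ.IsPath u p v ∧ Γ.IsPath v q w := by
  induction p generalizing u with
  | nil => exact ⟨u, rfl, h⟩
  | cons e p ih =>
    obtain ⟨v, h1, h2⟩ := ih h.2
    exact ⟨v, ⟨h.1, h1⟩, h2⟩

/-- Edge paths from `u` to `v`. -/
def Path (u v : V) : Type _ := {p : List E // Γ.IsPath u p v}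

/-- `q` arises from `p` by removing one backtrack `e · e⁻¹`. -/
def Cancels {u v : V} (p q : Γ.Path u v) : Prop :=
  ∃ (a b : List E) (e : E), p.1 = a ++ e :: Γ.rev e :: b ∧ q.1 = a ++ b

/-- Homotopy of edge paths relative to their endpoints: the equivalence relation generated by
insertions and removals of backtracks. -/
def homotopy (u v : V) : Setoid (Γ.Path u v) := Relation.EqvGen.setoid Γ.Cancels

/-- Homotopy classes, relative to the endpoints, of edge paths from `u` to `v`. -/
def HomotopyClass (u v : V) : Type _ := Quotient (Γ.homotopy u v)

variable {Γ}

/-- A map of paths that respects removal of one backtrack up to homotopy respects homotopy. -/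
theorem homotopy_map {V' E' : Type*} {Γ' : OrientedGraph V' E'} {u v : V} {u' v' : V'}
    (m : Γ.Path u v → Γ'.Path u' v')
    (hm : ∀ p q, Γ.Cancels p q → (Γ'.homotopy u' v') (m p) (m q)) {p q : Γ.Path u v}
    (h : (Γ.homotopy u v) p q) : (Γ'.homotopy u' v') (m p) (m q) := by
  induction h with
  | rel p q h => exact hm p q h
  | refl p => exact (Γ'.homotopy u' v').refl _
  | symm p q _ ih => exact (Γ'.homotopy u' v').symm ih
  | trans p q r _ _ ih1 ih2 => exact (Γ'.homotopy u' v').trans ih1 ih2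

/-- Concatenation of edge paths. -/
def Path.trans {u v w : V} (p : Γ.Path u v) (q : Γ.Path v w) : Γ.Path u w :=
  ⟨p.1 ++ q.1, IsPath.append Γ p.2 q.2⟩

/-- Reversal of edge paths. -/
def Path.symm {u v : V} (p : Γ.Path u v) : Γ.Path v u := ⟨Γ.revPath p.1, IsPath.rev Γ p.2⟩

/-- Concatenation of homotopy classes. -/
def HomotopyClass.trans {u v w : V} (x : Γ.HomotopyClass u v) (y : Γ.HomotopyClass v w) :
    Γ.HomotopyClass u w :=
  Quotient.map₂ Path.trans (by
    intro p p' hp q q' hq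
    refine (Γ.homotopy u w).trans (b := Path.trans p' q) ?_ ?_
    · refine homotopy_map (fun r => Path.trans r q) ?_ hp
      rintro r s ⟨a, b, e, hr, hs⟩
      exact Relation.EqvGen.rel _ _ ⟨a, b ++ q.1, e, by simp [Path.trans, hr],
        by simp [Path.trans, hs]⟩
    · refine homotopy_map (fun r => Path.trans p' r) ?_ hq
      rintro r s ⟨a, b, e, hr, hs⟩
      exact Relation.EqvGen.rel _ _ ⟨p'.1 ++ a, b, e, by simp [Path.trans, hr],
        by simp [Path.trans, hs]⟩) x y

/-- Reversal of homotopy classes. -/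
def HomotopyClass.symm {u v : V} (x : Γ.HomotopyClass u v) : Γ.HomotopyClass v u :=
  Quotient.map Path.symm (by
    intro p q hpq
    refine homotopy_map Path.symm ?_ hpq
    rintro r s ⟨a, b, e, hr, hs⟩
    exact Relation.EqvGen.rel _ _ ⟨Γ.revPath b, Γ.revPath a, e,
      by simp [Path.symm, revPath, hr, Γ.rev_rev], by simp [Path.symm, revPath, hs]⟩) x

/-- A detour `w · w⁻¹` in the middle of a path can be removed by a homotopy. -/
theorem homotopy_detour {u v : V} (w a b : List E)
    (h : Γ.IsPath u (a ++ w ++ Γ.revPath w ++ b) v) (h' : Γ.IsPath u (a ++ b) v) :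
    (Γ.homotopy u v) ⟨a ++ w ++ Γ.revPath w ++ b, h⟩ ⟨a ++ b, h'⟩ := by
  induction w generalizing a b with
  | nil =>
    have : (⟨a ++ [] ++ Γ.revPath [] ++ b, h⟩ : Γ.Path u v) = ⟨a ++ b, h'⟩ :=
      Subtype.ext (by simp [revPath])
    rw [this]
    exact (Γ.homotopy u v).refl _
  | cons e w ih =>
    have h1 : a ++ (e :: w) ++ Γ.revPath (e :: w) ++ b
        = (a ++ [e]) ++ w ++ Γ.revPath w ++ (Γ.rev e :: b) := by simp [revPath]
    have h2 : Γ.IsPath u ((a ++ [e]) ++ (Γ.rev e :: b)) v := by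
      rw [h1] at h
      obtain ⟨x, hx, hb⟩ := IsPath.of_append Γ h
      obtain ⟨y, hy, hr⟩ := IsPath.of_append Γ hx
      obtain ⟨z, hz, hw⟩ := IsPath.of_append Γ hy
      have hr' := IsPath.rev Γ hr
      have hrr : Γ.revPath (Γ.revPath w) = w := by
        simp [revPath, Function.comp_def, Γ.rev_rev]
      rw [hrr] at hr'
      have hzx : z = x := by
        by_cases hw0 : w = []
        · subst hw0
          have e1 : z = y := hw
          have e2 : x = y := hr'
          rw [e1, e2]
        · cases w with
          | nil => exact absurd rfl hw0
          | cons c w => exact hw.1.symm.trans hr'.1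
      rw [← hzx] at hb
      exact IsPath.append Γ hz hb
    have h3 : (⟨a ++ (e :: w) ++ Γ.revPath (e :: w) ++ b, h⟩ : Γ.Path u v)
        = ⟨(a ++ [e]) ++ w ++ Γ.revPath w ++ (Γ.rev e :: b), h1 ▸ h⟩ := Subtype.ext h1
    rw [h3]
    refine (Γ.homotopy u v).trans (ih _ _ _ h2) ?_
    exact Relation.EqvGen.rel _ _ ⟨a, b, e, by simp, rfl⟩

variable (Γ) in
/-- The fundamental group of `Γ` based at `v`: homotopy classes of closed edge paths at `v`. -/
def FundGroup (v : V) : Type _ := Γ.HomotopyClass v v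

/-- Multiplication in the fundamental group is concatenation. -/
instance (v : V) : Group (Γ.FundGroup v) where
  mul x y := HomotopyClass.trans (Γ := Γ) x y
  one := Quotient.mk (Γ.homotopy v v) ⟨[], rfl⟩
  inv x := HomotopyClass.symm (Γ := Γ) x
  mul_assoc x y z := by
    induction x using Quotient.inductionOn
    induction y using Quotient.inductionOn
    induction z using Quotient.inductionOn
    exact congrArg (Quotient.mk _) (Subtype.ext (List.append_assoc _ _ _))
  one_mul x := by
    induction x using Quotient.inductionOn
    rfl
  mul_one x := by
    induction x using Quotient.inductionOn
    exact congrArg (Quotient.mk _) (Subtype.ext (List.append_nil _))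
  inv_mul_cancel x := by
    induction x using Quotient.inductionOn with
    | h p =>
      refine Quotient.sound (s := Γ.homotopy v v) ?_
      have hrr : Γ.revPath (Γ.revPath p.1) = p.1 := by
        simp [revPath, Function.comp_def, Γ.rev_rev]
      have h := homotopy_detour (Γ := Γ) (u := v) (v := v) (Γ.revPath p.1) [] []
        (by simpa [hrr] using IsPath.append Γ (IsPath.rev Γ p.2) p.2) rfl
      have e : (⟨[] ++ Γ.revPath p.1 ++ Γ.revPath (Γ.revPath p.1) ++ [],
          by simpa [hrr] using IsPath.append Γ (IsPath.rev Γ p.2) p.2⟩ : Γ.Path v v)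
          = Path.trans (Path.symm p) p := Subtype.ext (by simp [hrr, Path.trans, Path.symm])
      rw [e] at h
      exact h

end Paths

end OrientedGraph

/-! ### Graph maps, train tracks and clean maps -/

/-- A graph self-map that sends vertices to vertices and edges to edge paths, respecting endpoints
and reversal of orientation.  (A continuous map that sends vertices to vertices is, up to homotopy
relative to the vertices, of this form; collapsed edges have the empty path as image.) -/
structure GraphSelfMap {V E : Type*} (Γ : OrientedGraph V E) where
  onV : V → V
  onE : E → List E
  isPath_onE : ∀ e, Γ.IsPath (onV (Γ.src e)) (onE e) (onV (Γ.tgt e))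
  onE_rev : ∀ e, onE (Γ.rev e) = Γ.revPath (onE e)

namespace GraphSelfMap

section Maps

variable {V E : Type*} {Γ : OrientedGraph V E} (f : GraphSelfMap Γ)

/-- Image of an edge path (not tightened). -/
def mapPath (p : List E) : List E := p.flatMap f.onE

/-- The edge path `f ^ k (e)` (not tightened). -/
def iter (k : ℕ) (e : E) : List E := f.mapPath^[k] [e]

/-- The iterate `f ^ k` is locally injective in the interior of edges and at bivalent vertices:
edges have nontrivial reduced images, and the two half-edges at a bivalent vertex have images
with different initial half-edges. -/
def IterLocallyInjective (k : ℕ) : Prop :=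
  (∀ e, f.iter k e ≠ [] ∧ Γ.IsReduced (f.iter k e)) ∧
  ∀ e e', Γ.src e = Γ.src e' → Γ.valence (Γ.src e) = 2 → e ≠ e' →
    (f.iter k e).head? ≠ (f.iter k e').head?

/-- The geometric edge underlying `e'` occurs in the image of `e` under `f ^ k`. -/
def Crosses (k : ℕ) (e e' : E) : Prop := e' ∈ f.iter k e ∨ Γ.rev e' ∈ f.iter k e

/-- `f` is a train track map on a connected core graph. -/
def IsTrainTrack : Prop :=
  Γ.IsConnected ∧ Γ.IsCore ∧ ∀ k, 1 ≤ k → f.IterLocallyInjective k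

/-- For every pair of edges, some iterate of the second one crosses the first one. -/
def IsIrreducible : Prop := ∀ e' e, ∃ k, 1 ≤ k ∧ f.Crosses k e e'

/-- Some iterate maps every edge onto the whole graph. -/
def IsPrimitive : Prop := ∃ k, 1 ≤ k ∧ ∀ e e', f.Crosses k e e'

/-- The Whitehead graph of `f` at `v`.  Its vertices are the half-edges at `v`; two distinct
half-edges `a`, `b` are adjacent if the turn `{a, b}` is taken by the image of an edge under
an iterate of `f`, that is, if this image runs along `a⁻¹ · b` or along `b⁻¹ · a`. -/
def whiteheadGraph (v : V) : SimpleGraph {e : E // Γ.src e = v} :=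
  SimpleGraph.fromRel fun a b => ∃ (k : ℕ) (e : E), [Γ.rev a.1, b.1] <:+: f.iter k e

/-- A clean map: an irreducible train track map, all of whose Whitehead graphs are connected, with
an iterate that maps every edge onto the whole graph. -/
structure IsClean : Prop where
  isTrainTrack : f.IsTrainTrack
  isIrreducible : f.IsIrreducible
  connected_whiteheadGraph : ∀ v, (f.whiteheadGraph v).Connected
  isPrimitive : f.IsPrimitive

theorem isPath_mapPath {u v : V} {p : List E} (hp : Γ.IsPath u p v) :
    Γ.IsPath (f.onV u) (f.mapPath p) (f.onV v) := by
  induction p generalizing u with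
  | nil => exact congrArg f.onV hp
  | cons e p ih =>
    have h := OrientedGraph.IsPath.append Γ (f.isPath_onE e) (ih hp.2)
    rw [hp.1] at h
    simpa [mapPath] using h

/-- The map induced by `f` on homotopy classes of edge paths. -/
def mapClass {u v : V} (x : Γ.HomotopyClass u v) : Γ.HomotopyClass (f.onV u) (f.onV v) :=
  Quotient.map (sb := Γ.homotopy (f.onV u) (f.onV v))
    (fun p : Γ.Path u v =>
      (⟨f.mapPath p.1, f.isPath_mapPath p.2⟩ : Γ.Path (f.onV u) (f.onV v))) (by
    intro p q hpq
    refine OrientedGraph.homotopy_map (fun p : Γ.Path u v =>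
      (⟨f.mapPath p.1, f.isPath_mapPath p.2⟩ : Γ.Path (f.onV u) (f.onV v))) ?_ hpq
    rintro r s ⟨a, b, e, hr, hs⟩
    have e1 : f.mapPath r.1
        = f.mapPath a ++ f.onE e ++ Γ.revPath (f.onE e) ++ f.mapPath b := by
      simp [mapPath, hr, f.onE_rev]
    have e2 : f.mapPath s.1 = f.mapPath a ++ f.mapPath b := by simp [mapPath, hs]
    have h := OrientedGraph.homotopy_detour (Γ := Γ) (f.onE e) (f.mapPath a) (f.mapPath b)
      (e1 ▸ f.isPath_mapPath r.2) (e2 ▸ f.isPath_mapPath s.2)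
    have e3 : (⟨f.mapPath r.1, f.isPath_mapPath r.2⟩ : Γ.Path (f.onV u) (f.onV v))
      = ⟨_, e1 ▸ f.isPath_mapPath r.2⟩ := Subtype.ext e1
    have e4 : (⟨f.mapPath s.1, f.isPath_mapPath s.2⟩ : Γ.Path (f.onV u) (f.onV v))
      = ⟨_, e2 ▸ f.isPath_mapPath s.2⟩ := Subtype.ext e2
    change (Γ.homotopy (f.onV u) (f.onV v)) ⟨f.mapPath r.1, _⟩ ⟨f.mapPath s.1, _⟩
    rw [e3, e4]
    exact h) x

/-- `f` is a topological representative of the endomorphism `φ` of `F`: the graph is a connected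
core graph, `f` is locally injective in the interior of edges and at bivalent vertices, and there
is a marking `α : F ≃ π₁(Γ, v)` under which `f` induces `φ` up to inner automorphisms.  The
homomorphism `f_* : π₁(Γ, v) → π₁(Γ, f v)` is compared with `φ` through a path `c` from `v`
to `f v`; the inner automorphism is absorbed by the choice of `c`. -/
def IsRepresentative {F : Type*} [Group F] (φ : F →* F) : Prop :=
  Γ.IsConnected ∧ Γ.IsCore ∧ f.IterLocallyInjective 1 ∧
  ∃ (v : V) (α : F ≃* Γ.FundGroup v) (c : Γ.HomotopyClass v (f.onV v)),
    ∀ x : F, f.mapClass (α x) = c.symm.trans (OrientedGraph.HomotopyClass.trans (α (φ x)) c)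

end Maps

end GraphSelfMap

/-! ### Expanding conjugacy classes -/

open Classical in
/-- Length of a conjugacy class with respect to a basis of the free group `F`: the minimal
word length of its elements (the length of the corresponding cyclically reduced word). -/
noncomputable def conjClassLength {ι F : Type*} [Group F] (b : FreeGroupBasis ι F)
    (c : ConjClasses F) : ℕ :=
  sInf ((fun g => (b.repr g).norm) '' c.carrier)

/-- A conjugacy class is `φ`-expanding if the lengths of its images under the iterates of `φ`
are unbounded. -/
def IsExpandingConjClass {ι F : Type*} [Group F] (b : FreeGroupBasis ι F) (φ : Monoid.End F)
    (c : ConjClasses F) : Prop :=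
  ∀ L : ℕ, ∃ k : ℕ, L ≤ conjClassLength b (ConjClasses.map (φ ^ k) c)

/-! ### Reduction of edge paths -/

namespace OrientedGraph

section Reduction

variable {V E : Type*} (Γ : OrientedGraph V E)

/-! The marking labels every edge of $\Gamma$ by an element of $F$, and the labels define the
covering of $\Gamma$ with fibre $F/H$, in which the loops at the base point represent $H$. Since
$\phi(H) \le H$, the map $f$ lifts to a self-map $\tilde f$ of this covering: on fibres it is the
map of cosets induced by $\phi$, up to translation (`IsFibreMap`, `cosetMap`). It suffices that some
$\tilde f^n$ has finite image on fibres, for then $\phi^n(F)$ meets only finitely many cosets of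
$H$.

Because $H$ is finitely generated, a finite set $C$ of edges of the covering carries all reduced
loops at the base point (`exists_finite_core`), hence all cyclically reduced loops. Take a loop $p$
for an element of $H$ with expanding class. The cyclic reduction of $\tilde f^k(p)$ lies in $C$ and
becomes arbitrarily long. Iterated images of edges are reduced, so it consists of at most $|p|$
subpaths of lifts of paths $f^k(e)$. One of them is long enough to contain a full lift of some
$f^n(e')$. So for every $n$ some edge of the covering is mapped into $C$ by $\tilde f^n$
(`exists_liftStarts_nonempty`).

Cleanness spreads this to all edges (`exists_finite_range`). Let $S_n(e)$ be the set of image points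
of $\tilde f^n$ that start a lift of $f^n(e)$ inside $C$. Counting image points rather than
preimages keeps these sets finite. If $f^j(e)$ contains $e'$, a translate of $S_{n+j}(e)$ lies in
$S_n(e')$. By primitivity the cardinalities are therefore eventually independent of $n$ and $e$. The
inclusions at a turn taken by an iterate then become equalities, and connectedness of the Whitehead
graphs makes $S_n(e)$ depend only on the initial vertex of $e$. Once one edge of the covering is
mapped into $C$, so are all edges adjacent to it, and hence all edges of the connected covering. -/

theorem revPath_append (p q : List E) : Γ.revPath (p ++ q) = Γ.revPath q ++ Γ.revPath p := by
  simp [revPath]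

theorem revPath_revPath (p : List E) : Γ.revPath (Γ.revPath p) = p := by
  simp [revPath, Function.comp_def, Γ.rev_rev]

theorem tgt_rev (e : E) : Γ.tgt (Γ.rev e) = Γ.src e := by
  simp [tgt, Γ.rev_rev]

theorem IsPath.unique {u w w' : V} {p : List E} (h : Γ.IsPath u p w) (h' : Γ.IsPath u p w') :
    w = w' := by
  induction p generalizing u with
  | nil => exact h.symm.trans h'
  | cons e p ih => exact ih h.2 h'.2

variable {Γ}

theorem IsReduced.of_infix {p q : List E} (h : Γ.IsReduced q) (hpq : p <:+: q) :
    Γ.IsReduced p :=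
  List.IsChain.infix h hpq

theorem IsReduced.revPath {p : List E} (h : Γ.IsReduced p) : Γ.IsReduced (Γ.revPath p) := by
  unfold IsReduced OrientedGraph.revPath at *
  rw [List.isChain_reverse, List.isChain_map]
  refine h.imp fun a b hab hba => hab ?_
  simp only [Γ.rev_rev] at hba
  exact hba.symm

variable (Γ)

open Classical in
/-- Prepend an edge to a path and cancel the backtrack this may create. -/
noncomputable def push (e : E) : List E → List E
  | [] => [e]
  | a :: t => if a = Γ.rev e then t else e :: a :: t

open Classical in
theorem push_cons (e a : E) (t : List E) :
    Γ.push e (a :: t) = if a = Γ.rev e then t else e :: a :: t := rfl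

/-- The reduced path obtained from a path by removing backtracks. -/
noncomputable def reduce (p : List E) : List E := p.foldr Γ.push []

variable {Γ}

theorem IsReduced.push {p : List E} (h : Γ.IsReduced p) (e : E) : Γ.IsReduced (Γ.push e p) := by
  cases p with
  | nil => exact List.isChain_singleton e
  | cons a t =>
    rw [push_cons]
    split_ifs with ha
    · exact h.of_infix (List.suffix_cons a t).isInfix
    · exact List.isChain_cons_cons.2 ⟨ha, h⟩

variable (Γ) in
theorem isReduced_reduce (p : List E) : Γ.IsReduced (Γ.reduce p) := by
  induction p with
  | nil => exact List.isChain_nil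
  | cons e p ih => exact ih.push e

theorem IsReduced.reduce_eq {p : List E} (h : Γ.IsReduced p) : Γ.reduce p = p := by
  induction p with
  | nil => rfl
  | cons e p ih =>
    have hp := ih (h.of_infix (List.suffix_cons e p).isInfix)
    change Γ.push e (Γ.reduce p) = e :: p
    rw [hp]
    cases p with
    | nil => rfl
    | cons a t =>
      rw [push_cons]
      rw [if_neg (List.isChain_cons_cons.1 h).1]

/-- On reduced paths, pushing an edge and pushing its reverse are mutually inverse. This makes the
result of `reduce` independent of the order of cancellations. -/
theorem IsReduced.push_push_rev {p : List E} (h : Γ.IsReduced p) (e : E) :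
    Γ.push e (Γ.push (Γ.rev e) p) = p := by
  cases p with
  | nil => simp [OrientedGraph.push]
  | cons a t =>
    by_cases ha : a = e
    · subst ha
      cases t with
      | nil => simp [OrientedGraph.push, Γ.rev_rev]
      | cons b t =>
        have := (List.isChain_cons_cons.1 h).1
        simp [OrientedGraph.push, Γ.rev_rev, this]
    · simp [OrientedGraph.push, Γ.rev_rev, ha]

variable (Γ)

theorem reduce_cons (e : E) (p : List E) : Γ.reduce (e :: p) = Γ.push e (Γ.reduce p) := rfl

theorem reduce_append_congr (a : List E) {b b' : List E} (h : Γ.reduce b = Γ.reduce b') :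
    Γ.reduce (a ++ b) = Γ.reduce (a ++ b') := by
  induction a with
  | nil => exact h
  | cons e a ih => simp only [List.cons_append, reduce_cons, ih]

theorem reduce_cancel (a b : List E) (e : E) :
    Γ.reduce (a ++ e :: Γ.rev e :: b) = Γ.reduce (a ++ b) := by
  refine Γ.reduce_append_congr a ?_
  rw [reduce_cons, reduce_cons]
  exact (Γ.isReduced_reduce b).push_push_rev e

theorem sublist_push (e : E) (p : List E) : List.Sublist (Γ.push e p) (e :: p) := by
  cases p with
  | nil => exact List.Sublist.refl _
  | cons a t =>
    rw [push_cons]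
    split_ifs
    · exact (List.sublist_cons_self a t).trans (List.sublist_cons_self e _)
    · exact List.Sublist.refl _

theorem reduce_sublist (p : List E) : List.Sublist (Γ.reduce p) p := by
  induction p with
  | nil => exact List.Sublist.refl _
  | cons e p ih => exact (Γ.sublist_push e _).trans (ih.cons_cons e)

variable {Γ}

theorem IsPath.push {u w : V} {e : E} {p : List E} (h : Γ.IsPath u (e :: p) w) :
    Γ.IsPath u (Γ.push e p) w := by
  cases p with
  | nil => exact h
  | cons a t =>
    rw [push_cons]
    split_ifs with ha
    · have := h.2.2
      rw [ha, tgt_rev, h.1] at this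
      exact this
    · exact h

theorem IsPath.reduce {u w : V} {p : List E} (h : Γ.IsPath u p w) :
    Γ.IsPath u (Γ.reduce p) w := by
  induction p generalizing u with
  | nil => exact h
  | cons e p ih =>
    rw [reduce_cons]
    exact IsPath.push ⟨h.1, ih h.2⟩

/-- Reducing the concatenation of two reduced paths leaves a prefix of the first and a suffix of
the second one. -/
theorem exists_reduce_append_eq {a b : List E} (ha : Γ.IsReduced a) (hb : Γ.IsReduced b) :
    ∃ a' b', a' <+: a ∧ b' <:+ b ∧ Γ.reduce (a ++ b) = a' ++ b' := by
  induction a with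
  | nil => exact ⟨[], b, List.nil_prefix, List.suffix_refl b, hb.reduce_eq⟩
  | cons e a ih =>
    obtain ⟨a', b', h1, h2, h3⟩ := ih (ha.of_infix (List.suffix_cons e a).isInfix)
    simp only [List.cons_append, reduce_cons, h3]
    cases a' with
    | nil =>
      cases b' with
      | nil => exact ⟨[e], [], by simp, List.nil_suffix, rfl⟩
      | cons x t =>
        by_cases hx : x = Γ.rev e
        · exact ⟨[], t, List.nil_prefix, (List.suffix_cons x t).trans h2, by simp [push, hx]⟩
        · exact ⟨[e], x :: t, by simp, h2, by simp [push, hx]⟩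
    | cons x t =>
      obtain ⟨r, hr⟩ := h1
      rw [← hr] at ha
      have hx : x ≠ Γ.rev e := (List.isChain_cons_cons.1 ha).1
      exact ⟨e :: x :: t, b', ⟨r, by simp [← hr]⟩, h2, by simp [push, hx]⟩

/-- A reduced path is a conjugate of a cyclically reduced one. -/
theorem IsReduced.exists_cyclicallyReduced {p : List E} (hp : Γ.IsReduced p) :
    ∃ s q, p = s ++ q ++ Γ.revPath s ∧ Γ.IsReduced (q ++ q) := by
  induction hn : p.length using Nat.strong_induction_on generalizing p with
  | _ n ih =>
  rcases List.eq_nil_or_concat p with rfl | ⟨p', b, rfl⟩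
  · exact ⟨[], [], rfl, List.isChain_nil⟩
  by_cases hb : ∃ m, p' = Γ.rev b :: m
  · obtain ⟨m, rfl⟩ := hb
    obtain ⟨s, q, hm, hq⟩ := ih m.length (by simp at hn; omega)
      (hp.of_infix ⟨[Γ.rev b], [b], by simp⟩) rfl
    exact ⟨Γ.rev b :: s, q, by simp [hm, OrientedGraph.revPath, Γ.rev_rev], hq⟩
  · refine ⟨[], p' ++ [b], by simp [OrientedGraph.revPath], ?_⟩
    rw [List.concat_eq_append] at hp
    refine List.isChain_append.2 ⟨hp, hp, ?_⟩
    intro x hx y hy hxy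
    simp only [List.getLast?_append, List.getLast?_singleton, Option.some_or,
      Option.mem_some_iff] at hx
    subst hx hxy
    cases p' with
    | nil => simp at hy; exact Γ.rev_ne b hy.symm
    | cons a m => simp at hy; exact hb ⟨m, by rw [hy]⟩

theorem IsReduced.triple {q : List E} (h : Γ.IsReduced (q ++ q)) : Γ.IsReduced (q ++ q ++ q) := by
  cases q with
  | nil => exact List.isChain_nil
  | cons a q =>
    have h' := List.isChain_append.1 h
    refine List.isChain_append.2 ⟨h, h'.1, ?_⟩
    intro x hx
    refine h'.2.2 x ?_
    rw [List.getLast?_append] at hx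
    rwa [List.getLast?_eq_some_getLast (List.cons_ne_nil a q)] at hx ⊢

/-- If `C` contains the edges of all reduced closed paths at `v`, then it contains the edges of
all cyclically reduced closed paths that can be joined to `v`. -/
theorem mem_of_cyclicallyReduced {C : Set E} {v : V}
    (hC : ∀ p, Γ.IsPath v p v → Γ.IsReduced p → ∀ e ∈ p, e ∈ C) {w : V} {y q : List E}
    (hy : Γ.IsPath v y w) (hyr : Γ.IsReduced y) (hq : Γ.IsPath w q w)
    (hqr : Γ.IsReduced (q ++ q)) : ∀ e ∈ q, e ∈ C := by
  induction hn : y.length generalizing y q w with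
  | zero =>
    rw [List.length_eq_zero_iff] at hn
    subst hn
    cases hy
    exact hC q hq (hqr.of_infix (List.prefix_append q q).isInfix)
  | succ n ih =>
    rcases List.eq_nil_or_concat y with rfl | ⟨y', e, rfl⟩
    · simp at hn
    rw [List.concat_eq_append] at *
    have hq1 : Γ.IsReduced q := hqr.of_infix (List.prefix_append q q).isInfix
    have hyr' : Γ.IsReduced y' := hyr.of_infix (List.prefix_append _ _).isInfix
    obtain ⟨x, hy', he⟩ := IsPath.of_append Γ hy
    obtain ⟨rfl, hew⟩ := he
    have hew : Γ.tgt e = w := hew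
    subst hew
    have hlen : y'.length = n := by simpa using hn
    -- If `q` starts with the reverse of the last edge `e` of `y`, or ends with `e`, rotating `q` by
    -- one edge moves it to the preceding vertex of `y`; rotations of `q` are cyclically reduced
    -- because they square to infixes of `q ++ q ++ q`.
    by_cases h1 : ∃ r, q = Γ.rev e :: r
    · obtain ⟨r, rfl⟩ := h1
      have := ih (q := r ++ [Γ.rev e]) hy' hyr' ?_ ?_ hlen
      · intro a ha
        exact this a (by simpa [or_comm] using ha)
      · have h2 := hq.2
        rw [tgt_rev] at h2
        exact IsPath.append Γ h2 ⟨rfl, Γ.tgt_rev e⟩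
      · exact hqr.triple.of_infix ⟨[Γ.rev e], r, by simp⟩
    by_cases h2 : ∃ r, q = r ++ [e]
    · obtain ⟨r, rfl⟩ := h2
      have := ih (q := e :: r) hy' hyr' ?_ ?_ hlen
      · intro a ha
        exact this a (by simpa [or_comm] using ha)
      · obtain ⟨z, hz, hz'⟩ := IsPath.of_append Γ hq
        rw [← hz'.1] at hz
        exact ⟨rfl, hz⟩
      · exact hqr.triple.of_infix ⟨r, [e], by simp⟩
    -- Now nothing cancels in `y · q · y⁻¹`, so it is a reduced loop at `v`.
    intro a ha
    refine hC (y' ++ [e] ++ q ++ Γ.revPath (y' ++ [e]))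
      (IsPath.append Γ (IsPath.append Γ hy hq) (IsPath.rev Γ hy)) ?_ a (by simp [ha])
    refine List.isChain_append.2 ⟨List.isChain_append.2 ⟨hyr, hq1, ?_⟩, hyr.revPath, ?_⟩
    · intro b hb c hc hbc
      simp at hb
      subst hb hbc
      cases q with
      | nil => simp at hc
      | cons d r => simp at hc; exact h1 ⟨r, by rw [hc]⟩
    · intro b hb c hc hbc
      rcases List.eq_nil_or_concat q with rfl | ⟨r, d, rfl⟩
      · simp at ha
      · simp only [List.concat_eq_append, List.getLast?_append, List.getLast?_singleton,
          Option.some_or, Option.mem_some_iff] at hb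
        simp [revPath] at hc
        subst hb
        rw [hbc] at hc
        have := congrArg Γ.rev hc
        simp only [Γ.rev_rev] at this
        exact h2 ⟨r, by simp [this]⟩

end Reduction

end OrientedGraph

/-! ### Concatenations of lists from a family closed under infixes -/

section Concat

variable {α : Type*}

/-- `R` is a concatenation of at most `m` members of `A`. -/
def IsConcatOf (A : Set (List α)) (m : ℕ) (R : List α) : Prop :=
  ∃ L : List (List α), L.length ≤ m ∧ (∀ t ∈ L, t ∈ A) ∧ L.flatten = R

theorem List.infix_append_cases {t a b : List α} (h : t <:+: a ++ b) :
    t <:+: a ∨ t <:+: b ∨ ∃ t₁ t₂, t = t₁ ++ t₂ ∧ t₁ <:+ a ∧ t₂ <+: b := by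
  obtain ⟨l, r, h⟩ := h
  rw [List.append_assoc] at h
  rcases List.append_eq_append_iff.1 h with ⟨c, h1, h2⟩ | ⟨c, h1, h2⟩
  · rcases List.append_eq_append_iff.1 h2 with ⟨d, h3, h4⟩ | ⟨d, h3, h4⟩
    · exact Or.inl ⟨l, d, by rw [h1, h3]; simp⟩
    · exact Or.inr (Or.inr ⟨c, d, h3, ⟨l, h1.symm⟩, ⟨r, h4.symm⟩⟩)
  · exact Or.inr (Or.inl ⟨c, r, by rw [h2]; simp⟩)

theorem IsConcatOf.of_infix {A : Set (List α)} (hA : ∀ s t, s <:+: t → t ∈ A → s ∈ A) {m : ℕ}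
    {R S : List α} (hR : IsConcatOf A m R) (hS : S <:+: R) : IsConcatOf A m S := by
  obtain ⟨L, hm, hL, rfl⟩ := hR
  induction L generalizing S m with
  | nil =>
    have : S = [] := by simpa using hS
    subst this
    exact ⟨[], Nat.zero_le m, by simp, rfl⟩
  | cons a L ih =>
    obtain ⟨m, rfl⟩ : ∃ m', m = m' + 1 := ⟨m - 1, by simp at hm; omega⟩
    have hm' : L.length ≤ m := by simpa using hm
    have hL' : ∀ t ∈ L, t ∈ A := fun t ht => hL t (by simp [ht])
    rw [List.flatten_cons] at hS
    rcases List.infix_append_cases hS with h | h | ⟨t₁, t₂, rfl, h1, h2⟩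
    · exact ⟨[S], by simp, by simpa using hA S a h (hL a (by simp)), by simp⟩
    · obtain ⟨M, h1, h2, h3⟩ := ih hm' hL' h
      exact ⟨M, by omega, h2, h3⟩
    · obtain ⟨M, h3, h4, h5⟩ := ih hm' hL' h2.isInfix
      refine ⟨t₁ :: M, by simpa using h3, ?_, by simp [h5]⟩
      intro t ht
      rcases List.mem_cons.1 ht with rfl | ht
      · exact hA _ a h1.isInfix (hL a (by simp))
      · exact h4 t ht

/-- Pigeonhole: `m` pieces of length at most `K` cannot fill more than `m * K`. -/
theorem IsConcatOf.exists_long {A : Set (List α)} {m K : ℕ} {R : List α}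
    (hR : IsConcatOf A m R) (hlen : m * K < R.length) : ∃ t ∈ A, t <:+: R ∧ K < t.length := by
  obtain ⟨L, hm, hL, rfl⟩ := hR
  by_contra! hcon
  have h1 : ∀ t ∈ L, t.length ≤ K := fun t ht =>
    hcon t (hL t ht) (by
      obtain ⟨l, r, rfl⟩ := List.append_of_mem ht
      exact ⟨l.flatten, r.flatten, by simp⟩)
  have h2 : L.flatten.length ≤ L.length * K := by
    rw [List.length_flatten]
    have := List.sum_le_card_nsmul (L.map List.length) K (by simpa using h1)
    simpa using this
  have := Nat.mul_le_mul_right K hm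
  omega

/-- A sufficiently long piece of a concatenation of short lists contains one of them. -/
theorem List.exists_infix_of_infix_flatten {L : List (List α)} {K : ℕ}
    (hL : ∀ l ∈ L, l.length ≤ K) {t : List α} (ht : t <:+: L.flatten) (hlen : 2 * K < t.length) :
    ∃ l ∈ L, l <:+: t := by
  induction L with
  | nil =>
    have : t = [] := by simpa using ht
    simp [this] at hlen
  | cons a L ih =>
    have hL' : ∀ l ∈ L, l.length ≤ K := fun l hl => hL l (by simp [hl])
    have ha := hL a (by simp)
    rw [List.flatten_cons] at ht
    rcases List.infix_append_cases ht with h | h | ⟨t₁, t₂, rfl, h1, h2⟩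
    · have := h.length_le
      omega
    · obtain ⟨l, hl, h⟩ := ih hL' h
      exact ⟨l, by simp [hl], h⟩
    -- At most `K` entries lie in the first block `a`, so more than `K` remain, enough to cover the
    -- whole next block.
    · have h3 := h1.length_le
      rw [List.length_append] at hlen
      cases L with
      | nil =>
        have : t₂ = [] := by simpa using h2
        simp [this] at hlen
        omega
      | cons b L =>
        have hb := hL b (by simp)
        have : b <+: t₂ := List.prefix_of_prefix_length_le
          (List.prefix_append b L.flatten) (by simpa using h2) (by omega)
        exact ⟨b, by simp, this.isInfix.trans (List.suffix_append t₁ t₂).isInfix⟩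

/-- Between reduced paths cancellation happens only at the junctions, so each piece survives as a
subpath and the number of pieces does not grow. -/
theorem OrientedGraph.isConcatOf_reduce_flatten {V E : Type*} {Γ : OrientedGraph V E}
    {A : Set (List E)} (hA : ∀ s t, s <:+: t → t ∈ A → s ∈ A) (L : List (List E))
    (hL : ∀ t ∈ L, t ∈ A ∧ Γ.IsReduced t) : IsConcatOf A L.length (Γ.reduce L.flatten) := by
  induction L with
  | nil => exact ⟨[], by simp, by simp, rfl⟩
  | cons a L ih =>
    have ih := ih fun t ht => hL t (by simp [ht])
    obtain ⟨a', b', h1, h2, h3⟩ := Γ.exists_reduce_append_eq (hL a (by simp)).2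
      (Γ.isReduced_reduce L.flatten)
    rw [List.flatten_cons, Γ.reduce_append_congr a (b' := Γ.reduce L.flatten)
      (Γ.isReduced_reduce _).reduce_eq.symm, h3]
    obtain ⟨M, h4, h5, h6⟩ := ih.of_infix hA h2.isInfix
    refine ⟨a' :: M, by simpa using h4, ?_, by simp [h6]⟩
    intro t ht
    rcases List.mem_cons.1 ht with rfl | ht
    · exact hA _ a h1.isInfix (hL a (by simp)).1
    · exact h5 t ht

end Concat

/-! ### Coverings defined by labels of the edges in a group -/

/-- The label of a path. -/
def pathLabel {E F : Type*} [Group F] (l : E → F) (p : List E) : F := (p.map l).prod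

/-- The lift, starting at `x`, of a path to the covering defined by the labels. -/
def pathLift {E F X : Type*} [Group F] [MulAction F X] (l : E → F) : X → List E → List (E × X)
  | _, [] => []
  | x, e :: p => (e, x) :: pathLift l ((l e)⁻¹ • x) p

section Labels

variable {E F X : Type*} [Group F] [MulAction F X] (l : E → F)

theorem pathLabel_cons (e : E) (p : List E) : pathLabel l (e :: p) = l e * pathLabel l p := by
  simp [pathLabel]

theorem pathLabel_append (p q : List E) :
    pathLabel l (p ++ q) = pathLabel l p * pathLabel l q := by
  simp [pathLabel]

theorem pathLabel_singleton (e : E) : pathLabel l [e] = l e := by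
  simp [pathLabel]

/-- Labels multiply from left to right along a path but act from the left on the fibre, so transport
along `p` is the action of the inverse of its label. -/
theorem pathLift_append (x : X) (p q : List E) :
    pathLift l x (p ++ q) = pathLift l x p ++ pathLift l ((pathLabel l p)⁻¹ • x) q := by
  induction p generalizing x with
  | nil => simp [pathLift, pathLabel]
  | cons e p ih => simp [pathLift, ih, pathLabel_cons, mul_smul]

theorem map_fst_pathLift (x : X) (p : List E) : (pathLift l x p).map Prod.fst = p := by
  induction p generalizing x with
  | nil => rfl
  | cons e p ih => simp [pathLift, ih]

theorem length_pathLift (x : X) (p : List E) : (pathLift l x p).length = p.length := by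
  conv_rhs => rw [← map_fst_pathLift l x p]
  rw [List.length_map]

end Labels

/-! ### The covering graph and unique path lifting -/

namespace OrientedGraph

variable {V E F X : Type*} [Group F] [MulAction F X] (Γ : OrientedGraph V E) {l : E → F}

theorem pathLabel_revPath (hl : ∀ e, l (Γ.rev e) = (l e)⁻¹)
    (p : List E) : pathLabel l (Γ.revPath p) = (pathLabel l p)⁻¹ := by
  induction p with
  | nil => simp [pathLabel, revPath]
  | cons e p ih =>
    have h : Γ.revPath (e :: p) = Γ.revPath p ++ [Γ.rev e] := by simp [revPath]
    rw [h, pathLabel_append, ih, pathLabel_singleton, hl, pathLabel_cons, mul_inv_rev]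

theorem pathLabel_push (hl : ∀ e, l (Γ.rev e) = (l e)⁻¹)
    (e : E) (p : List E) :
    pathLabel l (Γ.push e p) = pathLabel l (e :: p) := by
  cases p with
  | nil => rfl
  | cons a t =>
    rw [push_cons]
    split_ifs with ha
    · simp [pathLabel_cons, ha, hl]
    · rfl

theorem pathLabel_reduce (hl : ∀ e, l (Γ.rev e) = (l e)⁻¹)
    (p : List E) : pathLabel l (Γ.reduce p) = pathLabel l p := by
  induction p with
  | nil => rfl
  | cons e p ih => rw [reduce_cons, Γ.pathLabel_push hl, pathLabel_cons, pathLabel_cons, ih]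

variable (hl : ∀ e, l (Γ.rev e) = (l e)⁻¹)

variable (X) in
/-- The covering of `Γ` with fibre `X` defined by the labels of the edges. -/
def cover : OrientedGraph (V × X) (E × X) where
  src a := (Γ.src a.1, a.2)
  rev a := (Γ.rev a.1, (l a.1)⁻¹ • a.2)
  rev_rev a := by simp [Γ.rev_rev, hl]
  rev_ne a h := Γ.rev_ne a.1 (congrArg Prod.fst h)

theorem cover_tgt (e : E) (x : X) : (Γ.cover X hl).tgt (e, x) = (Γ.tgt e, (l e)⁻¹ • x) := rfl

theorem isPath_pathLift {u w : V} {p : List E} (hp : Γ.IsPath u p w) (x : X) :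
    (Γ.cover X hl).IsPath (u, x) (pathLift l x p) (w, (pathLabel l p)⁻¹ • x) := by
  induction p generalizing u x with
  | nil => simp [pathLift, pathLabel, IsPath]; exact hp
  | cons e p ih =>
    refine ⟨Prod.ext hp.1 rfl, ?_⟩
    rw [cover_tgt, pathLabel_cons, mul_inv_rev, mul_smul]
    exact ih hp.2 _

theorem exists_eq_pathLift {a b : V × X} {P : List (E × X)} (hP : (Γ.cover X hl).IsPath a P b) :
    Γ.IsPath a.1 (P.map Prod.fst) b.1 ∧ P = pathLift l a.2 (P.map Prod.fst) ∧
      b.2 = (pathLabel l (P.map Prod.fst))⁻¹ • a.2 := by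
  induction P generalizing a with
  | nil => cases hP; simp [IsPath, pathLift, pathLabel]
  | cons c P ih =>
    obtain ⟨h0, h⟩ := hP
    obtain ⟨h1, h2, h3⟩ := ih h
    subst h0
    refine ⟨⟨rfl, h1⟩, ?_, ?_⟩
    · change c :: P = c :: pathLift l ((l c.1)⁻¹ • c.2) (P.map Prod.fst)
      exact congrArg _ h2
    · rw [List.map_cons, pathLabel_cons, mul_inv_rev, mul_smul]
      exact h3

theorem revPath_pathLift (p : List E) (x : X) : (Γ.cover X hl).revPath (pathLift l x p) =
    pathLift l ((pathLabel l p)⁻¹ • x) (Γ.revPath p) := by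
  induction p generalizing x with
  | nil => rfl
  | cons e p ih =>
    have h : Γ.revPath (e :: p) = Γ.revPath p ++ [Γ.rev e] := by simp [revPath]
    have h' : (Γ.cover X hl).revPath ((e, x) :: pathLift l ((l e)⁻¹ • x) p) =
      (Γ.cover X hl).revPath (pathLift l ((l e)⁻¹ • x) p) ++ [(Γ.rev e, (l e)⁻¹ • x)] := by
      simp [revPath, cover]
    rw [h, pathLift_append, Γ.pathLabel_revPath hl, pathLift, h', ih, pathLabel_cons, inv_inv]
    simp [pathLift, mul_smul]

/-- Consecutive edges of a lift already agree in the fibre coordinate that a backtrack requires, so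
only the underlying edges matter. -/
theorem isReduced_pathLift_iff (p : List E) (x : X) :
    (Γ.cover X hl).IsReduced (pathLift l x p) ↔ Γ.IsReduced p := by
  unfold IsReduced
  induction p generalizing x with
  | nil => simp [pathLift]
  | cons e p ih =>
    cases p with
    | nil => simp [pathLift]
    | cons a p =>
      have := ih ((l e)⁻¹ • x)
      simp only [pathLift] at this ⊢
      rw [List.isChain_cons_cons, List.isChain_cons_cons, this]
      refine and_congr_left fun _ => not_congr ?_
      simp [cover]

end OrientedGraph

/-! ### Iterates of a graph map on a covering -/

namespace GraphSelfMap

section FibreIter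

variable {V E F X : Type*} [Group F] [MulAction F X] {Γ : OrientedGraph V E} (f : GraphSelfMap Γ)

theorem mapPath_append (p q : List E) : f.mapPath (p ++ q) = f.mapPath p ++ f.mapPath q := by
  simp [mapPath]

theorem mapPath_iterate_append (n : ℕ) (p q : List E) :
    f.mapPath^[n] (p ++ q) = f.mapPath^[n] p ++ f.mapPath^[n] q := by
  induction n generalizing p q with
  | zero => rfl
  | succ n ih => simp only [Function.iterate_succ_apply, mapPath_append, ih]

theorem mapPath_iterate_nil (n : ℕ) : f.mapPath^[n] [] = [] := by
  induction n with
  | zero => rfl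
  | succ n ih => exact ih

theorem mapPath_iterate_cons (n : ℕ) (e : E) (p : List E) :
    f.mapPath^[n] (e :: p) = f.iter n e ++ f.mapPath^[n] p :=
  f.mapPath_iterate_append n [e] p

theorem iter_add (n j : ℕ) (e : E) : f.iter (n + j) e = f.mapPath^[n] (f.iter j e) :=
  Function.iterate_add_apply _ _ _ _

theorem mapPath_revPath (p : List E) : f.mapPath (Γ.revPath p) = Γ.revPath (f.mapPath p) := by
  induction p with
  | nil => rfl
  | cons e p ih =>
    have h : Γ.revPath (e :: p) = Γ.revPath p ++ [Γ.rev e] := by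
      simp [OrientedGraph.revPath]
    have h1 : f.mapPath [Γ.rev e] = Γ.revPath (f.onE e) := by simp [mapPath, f.onE_rev]
    have h2 : f.mapPath (e :: p) = f.onE e ++ f.mapPath p := by simp [mapPath]
    rw [h, mapPath_append, ih, h1, h2, Γ.revPath_append]

theorem iter_rev (n : ℕ) (e : E) : f.iter n (Γ.rev e) = Γ.revPath (f.iter n e) := by
  induction n with
  | zero => simp [iter, OrientedGraph.revPath]
  | succ n ih =>
    have h (a : E) : f.iter (n + 1) a = f.mapPath (f.iter n a) :=
      Function.iterate_succ_apply' _ _ _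
    rw [h, h, ih, mapPath_revPath]

theorem isPath_mapPath_iterate (n : ℕ) {u w : V} {p : List E} (hp : Γ.IsPath u p w) :
    Γ.IsPath (f.onV^[n] u) (f.mapPath^[n] p) (f.onV^[n] w) := by
  induction n generalizing u w p with
  | zero => exact hp
  | succ n ih => exact ih (f.isPath_mapPath hp)

theorem isPath_singleton (e : E) : Γ.IsPath (Γ.src e) [e] (Γ.tgt e) := ⟨rfl, rfl⟩

theorem isPath_iter (n : ℕ) (e : E) :
    Γ.IsPath (f.onV^[n] (Γ.src e)) (f.iter n e) (f.onV^[n] (Γ.tgt e)) :=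
  f.isPath_mapPath_iterate n (isPath_singleton e)

/-- The iterates of a map on the fibres that covers `f`. -/
def fibreIter (g : V → X → X) : ℕ → V → X → X
  | 0, _, x => x
  | n + 1, u, x => fibreIter g n (f.onV u) (g u x)

theorem fibreIter_add (g : V → X → X) (n j : ℕ) (u : V) (x : X) :
    f.fibreIter g (n + j) u x = f.fibreIter g n (f.onV^[j] u) (f.fibreIter g j u x) := by
  induction j generalizing u x with
  | zero => rfl
  | succ j ih => exact ih (f.onV u) (g u x)

/-- The family `g` of maps between the fibres is compatible with transport along edges. -/
def IsFibreMap (l : E → F) (g : V → X → X) : Prop :=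
  ∀ e x, g (Γ.tgt e) ((l e)⁻¹ • x) = (pathLabel l (f.onE e))⁻¹ • g (Γ.src e) x

variable {f} {l : E → F} {g : V → X → X}

theorem IsFibreMap.path (hg : f.IsFibreMap l g) {u w : V} {p : List E} (hp : Γ.IsPath u p w)
    (x : X) : g w ((pathLabel l p)⁻¹ • x) = (pathLabel l (f.mapPath p))⁻¹ • g u x := by
  induction p generalizing u x with
  | nil => cases hp; simp [pathLabel, mapPath]
  | cons e p ih =>
    have h2 : f.mapPath (e :: p) = f.onE e ++ f.mapPath p := by simp [mapPath]
    rw [h2, pathLabel_cons, pathLabel_append, mul_inv_rev, mul_inv_rev, mul_smul, mul_smul,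
      ih hp.2, hg, hp.1]

theorem IsFibreMap.fibreIter_path (hg : f.IsFibreMap l g) (n : ℕ) {u w : V} {p : List E}
    (hp : Γ.IsPath u p w) (x : X) : f.fibreIter g n w ((pathLabel l p)⁻¹ • x) =
      (pathLabel l (f.mapPath^[n] p))⁻¹ • f.fibreIter g n u x := by
  induction n generalizing u w p x with
  | zero => rfl
  | succ n ih =>
    change f.fibreIter g n (f.onV w) (g w _) = _
    rw [hg.path hp, ih (f.isPath_mapPath hp)]
    rfl

/-- Images under `f ^ n` of the lifts of the initial vertex of `e` that start a lift of
`f ^ n (e)` inside `C`. -/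
def liftStarts (f : GraphSelfMap Γ) (l : E → F) (g : V → X → X) (C : Set (E × X)) (n : ℕ)
    (e : E) : Set X :=
  {y | (∃ x, f.fibreIter g n (Γ.src e) x = y) ∧ ∀ a ∈ pathLift l y (f.iter n e), a ∈ C}

variable {C : Set (E × X)}

/-- As `f.iter n e` is nonempty, the starting point is the fibre coordinate of the first edge of the
lift, which lies in `C`. -/
theorem finite_liftStarts (hC : C.Finite) {n : ℕ} {e : E} (hne : f.iter n e ≠ []) :
    (f.liftStarts l g C n e).Finite := by
  refine (hC.image Prod.snd).subset ?_
  rintro y ⟨-, hy⟩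
  obtain ⟨a, p, hp⟩ := List.exists_cons_of_ne_nil hne
  exact ⟨(a, y), hy _ (by simp [hp, pathLift]), rfl⟩

/-- Inside the lift of `f ^ (n + j) (e)` sits a lift of `f ^ n (e')`; transport along the preceding
segment `f ^ n (a)` moves the start of the former to the start of the latter. -/
theorem IsFibreMap.smul_mem_liftStarts (hg : f.IsFibreMap l g) {n j : ℕ} {e e' : E}
    {a b : List E} (h : f.iter j e = a ++ e' :: b) {y : X}
    (hy : y ∈ f.liftStarts l g C (n + j) e) :
    (pathLabel l (f.mapPath^[n] a))⁻¹ • y ∈ f.liftStarts l g C n e' := by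
  obtain ⟨⟨x, rfl⟩, hy⟩ := hy
  have hp := f.isPath_iter j e
  rw [h] at hp
  obtain ⟨z, ha, hb⟩ := OrientedGraph.IsPath.of_append Γ hp
  obtain rfl := hb.1
  refine ⟨⟨(pathLabel l a)⁻¹ • f.fibreIter g j (Γ.src e) x, ?_⟩, fun c hc => hy c ?_⟩
  · rw [hg.fibreIter_path n ha, fibreIter_add]
  · rw [f.iter_add, h, f.mapPath_iterate_append, f.mapPath_iterate_cons, pathLift_append,
      pathLift_append]
    simp [hc]

theorem IsFibreMap.smul_mem_liftStarts_rev (hg : f.IsFibreMap l g)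
    (hl : ∀ e, l (Γ.rev e) = (l e)⁻¹) (hrev : ∀ a ∈ C, (Γ.cover X hl).rev a ∈ C) {n : ℕ} {e : E}
    {y : X} (hy : y ∈ f.liftStarts l g C n e) :
    (pathLabel l (f.iter n e))⁻¹ • y ∈ f.liftStarts l g C n (Γ.rev e) := by
  obtain ⟨⟨x, rfl⟩, hy⟩ := hy
  refine ⟨⟨(l e)⁻¹ • x, ?_⟩, ?_⟩
  · have := hg.fibreIter_path n (isPath_singleton e) x
    rw [pathLabel_singleton] at this
    exact this
  · rw [f.iter_rev, ← Γ.revPath_pathLift hl]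
    intro a ha
    simp only [OrientedGraph.revPath, List.mem_reverse, List.mem_map] at ha
    obtain ⟨b, hb, rfl⟩ := ha
    exact hrev b (hy b hb)

/-- If, for every `n`, the image under `f ^ n` of some edge of the covering lies in a fixed finite
set, then a power of the lift of `f` has finite image. -/
theorem IsFibreMap.exists_finite_range [Finite E] (hf : f.IsClean) (hg : f.IsFibreMap l g)
    (hl : ∀ e, l (Γ.rev e) = (l e)⁻¹)
    (hconn : ∀ u w (x y : X), ∃ p, Γ.IsPath u p w ∧ (pathLabel l p)⁻¹ • x = y)
    (hC : C.Finite) (hrev : ∀ a ∈ C, (Γ.cover X hl).rev a ∈ C)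
    (hne : ∀ n, ∃ e, (f.liftStarts l g C n e).Nonempty) :
    ∃ (n : ℕ) (T : Set X), T.Finite ∧ ∀ u x, f.fibreIter g n u x ∈ T := by
  have hnil : ∀ n e, f.iter n e ≠ [] := by
    intro n e
    rcases n with _ | n
    · simp [iter]
    · exact ((hf.isTrainTrack.2.2 (n + 1) (by omega)).1 e).1
  set S := f.liftStarts l g C with hS
  have hfin : ∀ n e, (S n e).Finite := fun n e => finite_liftStarts hC (hnil n e)
  have hle : ∀ n j e e', e' ∈ f.iter j e → (S (n + j) e).ncard ≤ (S n e').ncard := by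
    intro n j e e' he'
    obtain ⟨a, b, hab⟩ := List.append_of_mem he'
    exact Set.ncard_le_ncard_of_injOn _ (fun y hy => hg.smul_mem_liftStarts hab hy)
      (MulAction.injective _).injOn (hfin n e')
  have hler : ∀ n e, (S n e).ncard ≤ (S n (Γ.rev e)).ncard := fun n e =>
    Set.ncard_le_ncard_of_injOn _ (fun y hy => hg.smul_mem_liftStarts_rev hl hrev hy)
      (MulAction.injective _).injOn (hfin n _)
  obtain ⟨k, -, hk⟩ := hf.isPrimitive
  have hle' : ∀ n e e', (S (n + k) e).ncard ≤ (S n e').ncard := by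
    intro n e e'
    rcases hk e e' with h | h
    · exact hle n k e e' h
    · have := hler n (Γ.rev e')
      rw [Γ.rev_rev] at this
      exact (hle n k e _ h).trans this
  -- the cardinalities are eventually constant
  obtain ⟨n₀, N, hN⟩ : ∃ n₀ N, ∀ n ≥ n₀, ∀ e, (S n e).ncard = N := by
    obtain ⟨e₁, -⟩ := hne 0
    obtain ⟨⟨n₀, e₀⟩, hmin⟩ : ∃ m : ℕ × E, ∀ m' : ℕ × E,
        (S m.1 m.2).ncard ≤ (S m'.1 m'.2).ncard := by
      have : Nonempty (ℕ × E) := ⟨(0, e₁)⟩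
      exact ⟨Function.argmin fun m : ℕ × E => (S m.1 m.2).ncard,
        fun m' => Function.argmin_le (fun m : ℕ × E => (S m.1 m.2).ncard) m'⟩
    -- From the minimum at `(n₀, e₀)`, waiting `k` more steps bounds every edge by that minimum,
    -- since `f ^ k` of any edge crosses `e₀`; `hle` extends the bound to later `n`.
    refine ⟨n₀ + k, (S n₀ e₀).ncard, fun n hn e => le_antisymm ?_ (hmin (n, e))⟩
    obtain ⟨j, rfl⟩ := Nat.exists_eq_add_of_le hn
    obtain ⟨e', p, hp⟩ := List.exists_cons_of_ne_nil (hnil j e)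
    exact (hle (n₀ + k) j e e' (by simp [hp])).trans (hle' n₀ e' e₀)
  -- One translate of `S (n₀ + j) e` lies in both sets, and all three have `N` elements.
  have hturn : ∀ a b j e, [Γ.rev a, b] <:+: f.iter j e → S n₀ a = S n₀ b := by
    rintro a b j e ⟨p, r, hpr⟩
    have h1 : f.iter j e = p ++ Γ.rev a :: (b :: r) := by simp [← hpr]
    have h2 : f.iter j e = (p ++ [Γ.rev a]) ++ b :: r := by simp [← hpr]
    set t := (pathLabel l (f.mapPath^[n₀] (p ++ [Γ.rev a])))⁻¹ with ht
    have hb : (t • ·) '' S (n₀ + j) e ⊆ S n₀ b := by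
      rintro - ⟨y, hy, rfl⟩
      exact hg.smul_mem_liftStarts h2 hy
    have ha : (t • ·) '' S (n₀ + j) e ⊆ S n₀ a := by
      rintro - ⟨y, hy, rfl⟩
      have := hg.smul_mem_liftStarts_rev hl hrev (hg.smul_mem_liftStarts h1 hy)
      rw [Γ.rev_rev, ← mul_smul, ← mul_inv_rev, ← pathLabel_append] at this
      rw [ht, f.mapPath_iterate_append]
      exact this
    have hcard : ((t • ·) '' S (n₀ + j) e).ncard = N := by
      rw [Set.ncard_image_of_injective _ (MulAction.injective t)]
      exact hN _ (by omega) e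
    rw [← Set.eq_of_subset_of_ncard_le ha (by rw [hcard, hN n₀ le_rfl]) (hfin _ _),
      ← Set.eq_of_subset_of_ncard_le hb (by rw [hcard, hN n₀ le_rfl]) (hfin _ _)]
  have hvert : ∀ a b, Γ.src a = Γ.src b → S n₀ a = S n₀ b := by
    intro a b hab
    have hc := (hf.connected_whiteheadGraph (Γ.src b)).preconnected ⟨a, hab⟩ ⟨b, rfl⟩
    obtain ⟨w⟩ := hc
    suffices ∀ (c d : {e : E // Γ.src e = Γ.src b}),
        (f.whiteheadGraph (Γ.src b)).Walk c d → S n₀ c.1 = S n₀ d.1 from this _ _ w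
    intro c d w
    induction w with
    | nil => rfl
    | cons h _ ih =>
      refine Eq.trans ?_ ih
      rw [whiteheadGraph, SimpleGraph.fromRel_adj] at h
      rcases h.2 with ⟨j, e, h⟩ | ⟨j, e, h⟩
      · exact hturn _ _ j e h
      · exact (hturn _ _ j e h).symm
  -- Membership for one half-edge at a vertex gives it for all by `hvert`; reversing an edge carries
  -- it to the other end.
  have hstep : ∀ {u w : V} {p : List E} (x : X), Γ.IsPath u p w →
      (∀ a, Γ.src a = u → f.fibreIter g n₀ u x ∈ S n₀ a) → ∀ a, Γ.src a = w →
      f.fibreIter g n₀ w ((pathLabel l p)⁻¹ • x) ∈ S n₀ a := by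
    intro u w p x hp
    induction p generalizing u x with
    | nil => cases hp; simp [pathLabel]
    | cons e p ih =>
      intro h a ha
      obtain ⟨rfl, hp⟩ := hp
      rw [pathLabel_cons, mul_inv_rev, mul_smul]
      refine ih ((l e)⁻¹ • x) hp ?_ a ha
      intro b hb
      rw [hvert b (Γ.rev e) hb]
      have h1 := hg.smul_mem_liftStarts_rev hl hrev (h e rfl)
      have h2 := hg.fibreIter_path n₀ (isPath_singleton e) x
      rw [pathLabel_singleton] at h2
      rw [h2]
      exact h1
  obtain ⟨e₀, y₀, hy₀⟩ := hne n₀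
  obtain ⟨x₀, hx₀⟩ := hy₀.1
  refine ⟨n₀, ⋃ e, S n₀ e, Set.finite_iUnion fun e => hfin n₀ e, fun u x => ?_⟩
  obtain ⟨p, hp, rfl⟩ := hconn (Γ.src e₀) u x₀ x
  obtain ⟨⟨a, ha⟩⟩ := (hf.connected_whiteheadGraph u).nonempty
  refine Set.mem_iUnion.2 ⟨a, hstep x₀ hp ?_ a ha⟩
  intro b hb
  rw [hvert b e₀ hb, hx₀]
  exact hy₀

end FibreIter

end GraphSelfMap

/-! ### Long leaf segments in cyclically reduced images of a closed path -/

namespace GraphSelfMap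

section LeafSegments

variable {V E F X : Type*} [Group F] [MulAction F X] {Γ : OrientedGraph V E}
  {f : GraphSelfMap Γ} {l : E → F} {g : V → X → X} {C : Set (E × X)}

theorem IsFibreMap.exists_flatten_eq (hg : f.IsFibreMap l g) (n : ℕ) {u w : V} {p : List E}
    (hp : Γ.IsPath u p w) (x : X) :
    ∃ L : List (List (E × X)), L.length = p.length ∧
      (∀ t ∈ L, ∃ e x', t = pathLift l (f.fibreIter g n (Γ.src e) x') (f.iter n e)) ∧
      L.flatten = pathLift l (f.fibreIter g n u x) (f.mapPath^[n] p) := by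
  induction p generalizing u x with
  | nil => exact ⟨[], rfl, by simp, by simp [mapPath_iterate_nil, pathLift]⟩
  | cons e p ih =>
    obtain ⟨rfl, hp⟩ := hp
    obtain ⟨L, h1, h2, h3⟩ := ih hp ((l e)⁻¹ • x)
    refine ⟨pathLift l (f.fibreIter g n (Γ.src e) x) (f.iter n e) :: L, by simp [h1], ?_, ?_⟩
    · intro t ht
      rcases List.mem_cons.1 ht with rfl | ht
      · exact ⟨e, x, rfl⟩
      · exact h2 t ht
    · have := hg.fibreIter_path n (isPath_singleton e) x
      rw [pathLabel_singleton] at this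
      rw [List.flatten_cons, h3, f.mapPath_iterate_cons, pathLift_append, this]
      rfl

theorem IsFibreMap.exists_liftStarts_nonempty [Finite E] (hg : f.IsFibreMap l g)
    (hl : ∀ e, l (Γ.rev e) = (l e)⁻¹)
    (hconn : ∀ u w (x y : X), ∃ p, Γ.IsPath u p w ∧ (pathLabel l p)⁻¹ • x = y)
    (hred : ∀ n e, Γ.IsReduced (f.iter n e)) {v : V} {x₀ : X}
    (hC : ∀ P, (Γ.cover X hl).IsPath (v, x₀) P (v, x₀) → (Γ.cover X hl).IsReduced P →
      ∀ a ∈ P, a ∈ C)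
    {p : List E} (hp : Γ.IsPath v p v) (hpx : (pathLabel l p)⁻¹ • x₀ = x₀)
    (hexp : ∀ L : ℕ, ∃ k, ∀ q, IsConj (pathLabel l q) (pathLabel l (f.mapPath^[k] p)) →
      L < q.length) (n : ℕ) :
    ∃ e, (f.liftStarts l g C n e).Nonempty := by
  obtain ⟨K, hK⟩ : ∃ K, ∀ j ≤ n, ∀ e, (f.iter j e).length ≤ K := by
    have hfin : (Set.range fun m : Fin (n + 1) × E => (f.iter m.1 m.2).length).Finite :=
      Set.finite_range _
    obtain ⟨K, hK⟩ := hfin.bddAbove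
    exact ⟨K, fun j hj e => hK ⟨(⟨j, by omega⟩, e), rfl⟩⟩
  -- The reduced loop will split into at most `p.length` pieces; one must exceed `2 * K` in order to
  -- contain a complete block of length at most `K`.
  obtain ⟨k, hk⟩ := hexp (p.length * (2 * K))
  -- the lift of `f ^ k (p)` and its cyclically reduced core
  set x := f.fibreIter g k v x₀ with hx
  have hclosed : (pathLabel l (f.mapPath^[k] p))⁻¹ • x = x := by
    rw [hx, ← hg.fibreIter_path k hp, hpx]
  set P := pathLift l x (f.mapPath^[k] p) with hP
  have hPpath : (Γ.cover X hl).IsPath (f.onV^[k] v, x) P (f.onV^[k] v, x) := by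
    have := Γ.isPath_pathLift hl (f.isPath_mapPath_iterate k hp) x
    rwa [hclosed] at this
  obtain ⟨s, Q, hsQ, hQ⟩ := ((Γ.cover X hl).isReduced_reduce P).exists_cyclicallyReduced
  have hR := hPpath.reduce
  rw [hsQ] at hR
  obtain ⟨a, hsQ', hs'⟩ := OrientedGraph.IsPath.of_append _ hR
  obtain ⟨b, hs, hQpath⟩ := OrientedGraph.IsPath.of_append _ hsQ'
  have hab : a = b := by
    have h := OrientedGraph.IsPath.rev _ hs'
    rw [OrientedGraph.revPath_revPath] at h
    exact h.unique _ hs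
  subst hab
  -- The core loop need not pass through the base point, so it is joined to it by a reduced path in
  -- the connected covering.
  have hQC : ∀ c ∈ Q, c ∈ C := by
    obtain ⟨y, hy, hyx⟩ := hconn v a.1 x₀ a.2
    have hy' := Γ.isPath_pathLift hl hy x₀
    rw [hyx] at hy'
    exact OrientedGraph.mem_of_cyclicallyReduced hC hy'.reduce
      ((Γ.cover X hl).isReduced_reduce _) hQpath hQ
  -- it is long
  have hlab : IsConj (pathLabel l (Q.map Prod.fst)) (pathLabel l (f.mapPath^[k] p)) := by
    -- Reduction preserves labels and removing the tail `s` conjugates them, so `hexp` applies to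
    -- `Q`.
    let l' : E × X → F := fun c => l c.1
    have hl' : ∀ c, l' ((Γ.cover X hl).rev c) = (l' c)⁻¹ := fun c => hl c.1
    have hll (S : List (E × X)) : pathLabel l (S.map Prod.fst) = pathLabel l' S := by
      simp [pathLabel, l', Function.comp_def]
    have h1 : pathLabel l' P = pathLabel l (f.mapPath^[k] p) := by
      rw [← hll, hP, map_fst_pathLift]
    have h2 := (Γ.cover X hl).pathLabel_reduce hl' P
    rw [hsQ, pathLabel_append, pathLabel_append, (Γ.cover X hl).pathLabel_revPath hl', h1] at h2
    rw [hll]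
    exact isConj_iff.2 ⟨pathLabel l' s, h2⟩
  have hlen := hk _ hlab
  rw [List.length_map] at hlen
  -- hence it contains a long leaf segment
  let A : Set (List (E × X)) :=
    {t | ∃ e x', t <:+: pathLift l (f.fibreIter g k (Γ.src e) x') (f.iter k e)}
  have hA : ∀ s t, s <:+: t → t ∈ A → s ∈ A := by
    rintro s t hst ⟨e, x', h⟩
    exact ⟨e, x', hst.trans h⟩
  obtain ⟨L, hL1, hL2, hL3⟩ := hg.exists_flatten_eq k hp x₀
  have hcon : IsConcatOf A p.length Q := by
    rw [← hL1]
    refine IsConcatOf.of_infix hA (R := (Γ.cover X hl).reduce P) ?_ ⟨s, _, hsQ.symm⟩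
    rw [hP, ← hL3]
    refine OrientedGraph.isConcatOf_reduce_flatten hA L fun t ht => ?_
    obtain ⟨e, x', rfl⟩ := hL2 t ht
    exact ⟨⟨e, x', List.infix_refl _⟩, (Γ.isReduced_pathLift_iff hl _ _).2 (hred k e)⟩
  obtain ⟨t, ⟨e, x', ht⟩, htQ, htlen⟩ := hcon.exists_long hlen
  -- For `k < n` every leaf segment would have length at most `K`.
  have hnk : n ≤ k := by
    by_contra! h
    have h1 := ht.length_le
    rw [length_pathLift] at h1
    have h2 := hK k h.le e
    omega
  obtain ⟨j, rfl⟩ := Nat.exists_eq_add_of_le hnk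
  rw [f.iter_add, fibreIter_add] at ht
  obtain ⟨M, -, hM2, hM3⟩ := hg.exists_flatten_eq n (f.isPath_iter j e)
    (f.fibreIter g j (Γ.src e) x')
  rw [← hM3] at ht
  obtain ⟨m, hm, hmt⟩ := List.exists_infix_of_infix_flatten (K := K) (fun m hm => by
    obtain ⟨e', y, rfl⟩ := hM2 m hm
    rw [length_pathLift]
    exact hK n le_rfl e') ht htlen
  obtain ⟨e', y, rfl⟩ := hM2 m hm
  exact ⟨e', _, ⟨y, rfl⟩, fun c hc => hQC c ((hmt.trans htQ).subset hc)⟩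

end LeafSegments

end GraphSelfMap

/-! ### The fundamental groupoid and the labels defined by a marking -/

namespace OrientedGraph

section Groupoid

variable {V E : Type*} {Γ : OrientedGraph V E}

/-! ### Groupoid laws and uniqueness of reduced representatives -/

namespace HomotopyClass

/-- The homotopy class of an edge path. -/
def mk {u w : V} (p : List E) (hp : Γ.IsPath u p w) : Γ.HomotopyClass u w :=
  Quotient.mk (Γ.homotopy u w) ⟨p, hp⟩

variable {u w y z : V}

theorem exists_mk (x : Γ.HomotopyClass u w) : ∃ p, ∃ hp : Γ.IsPath u p w, x = mk p hp := by
  induction x using Quotient.inductionOn with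
  | h p => exact ⟨p.1, p.2, rfl⟩

theorem mk_congr {p q : List E} (h : p = q) (hp : Γ.IsPath u p w) :
    mk p hp = mk q (h ▸ hp) := by
  subst h
  rfl

theorem mk_trans_mk {p q : List E} (hp : Γ.IsPath u p w) (hq : Γ.IsPath w q y) :
    (mk p hp).trans (mk q hq) = mk (p ++ q) (IsPath.append Γ hp hq) := rfl

theorem symm_mk {p : List E} (hp : Γ.IsPath u p w) :
    (mk p hp).symm = mk (Γ.revPath p) (IsPath.rev Γ hp) := rfl

theorem trans_assoc (a : Γ.HomotopyClass u w) (b : Γ.HomotopyClass w y)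
    (c : Γ.HomotopyClass y z) : (a.trans b).trans c = a.trans (b.trans c) := by
  obtain ⟨p, hp, rfl⟩ := a.exists_mk
  obtain ⟨q, hq, rfl⟩ := b.exists_mk
  obtain ⟨r, hr, rfl⟩ := c.exists_mk
  simp only [mk_trans_mk]
  exact mk_congr (List.append_assoc p q r) _

theorem symm_symm (a : Γ.HomotopyClass u w) : a.symm.symm = a := by
  obtain ⟨p, hp, rfl⟩ := a.exists_mk
  simp only [symm_mk]
  exact mk_congr (Γ.revPath_revPath p) _

theorem trans_trans_symm (b : Γ.HomotopyClass u w) (a : Γ.HomotopyClass w y) :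
    (b.trans a).trans a.symm = b := by
  obtain ⟨p, hp, rfl⟩ := a.exists_mk
  obtain ⟨q, hq, rfl⟩ := b.exists_mk
  simp only [mk_trans_mk, symm_mk]
  have h := homotopy_detour (Γ := Γ) (u := u) (v := w) p q []
    (by simpa using IsPath.append Γ (IsPath.append Γ hq hp) (IsPath.rev Γ hp)) (by simpa using hq)
  have h' : mk _ _ = mk _ _ := Quotient.sound (s := Γ.homotopy u w) h
  rw [mk_congr (by simp : q ++ p ++ Γ.revPath p = q ++ p ++ Γ.revPath p ++ []),
    h', mk_congr (List.append_nil q)]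

theorem trans_symm_trans (b : Γ.HomotopyClass u w) (a : Γ.HomotopyClass y w) :
    (b.trans a.symm).trans a = b := by
  have := b.trans_trans_symm a.symm
  rwa [symm_symm] at this

theorem trans_right_cancel {a b : Γ.HomotopyClass u w} {c : Γ.HomotopyClass w y}
    (h : a.trans c = b.trans c) : a = b := by
  rw [← a.trans_trans_symm c, h, b.trans_trans_symm]

theorem symm_trans_trans (a : Γ.HomotopyClass u w) (b : Γ.HomotopyClass w y) :
    a.symm.trans (a.trans b) = b := by
  refine trans_right_cancel (c := b.symm) ?_
  rw [trans_assoc, trans_trans_symm]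
  obtain ⟨p, hp, rfl⟩ := a.exists_mk
  obtain ⟨q, hq, rfl⟩ := b.exists_mk
  have h1 := trans_symm_trans (mk [] rfl) (mk p hp)
  have h2 := trans_trans_symm (mk [] rfl) (mk q hq)
  exact h1.trans h2.symm

theorem trans_symm_trans_left (a : Γ.HomotopyClass w u) (b : Γ.HomotopyClass w y) :
    a.trans (a.symm.trans b) = b := by
  have := a.symm.symm_trans_trans b
  rwa [symm_symm] at this

theorem reduce_eq_of_homotopy {p q : Γ.Path u w} (h : (Γ.homotopy u w) p q) :
    Γ.reduce p.1 = Γ.reduce q.1 := by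
  induction h with
  | rel p q h =>
    obtain ⟨a, b, e, h1, h2⟩ := h
    rw [h1, h2, reduce_cancel]
  | refl p => rfl
  | symm p q _ ih => exact ih.symm
  | trans p q r _ _ ih1 ih2 => exact ih1.trans ih2

theorem eq_of_mk_eq_mk {p q : List E} {hp : Γ.IsPath u p w} {hq : Γ.IsPath u q w}
    (h : mk p hp = mk q hq) (hpr : Γ.IsReduced p) (hqr : Γ.IsReduced q) : p = q := by
  have := reduce_eq_of_homotopy (Quotient.exact h)
  rwa [hpr.reduce_eq, hqr.reduce_eq] at this

theorem mapClass_trans (f : GraphSelfMap Γ) (a : Γ.HomotopyClass u w)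
    (b : Γ.HomotopyClass w y) : f.mapClass (a.trans b) = (f.mapClass a).trans (f.mapClass b) := by
  obtain ⟨p, hp, rfl⟩ := a.exists_mk
  obtain ⟨q, hq, rfl⟩ := b.exists_mk
  exact mk_congr (f.mapPath_append p q) _

theorem mapClass_symm (f : GraphSelfMap Γ) (a : Γ.HomotopyClass u w) :
    f.mapClass a.symm = (f.mapClass a).symm := by
  obtain ⟨p, hp, rfl⟩ := a.exists_mk
  exact mk_congr (f.mapPath_revPath p) _

end HomotopyClass

/-! ### Group labels of paths and the action of `φ` on them -/

section Coordinates

variable {F : Type*} [Group F] {v : V} (α : F ≃* Γ.FundGroup v)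
  (t : ∀ u, Γ.HomotopyClass v u)

/-- A homotopy class of closed paths, as an element of the fundamental group. -/
def toFundGroup {v : V} (x : Γ.HomotopyClass v v) : Γ.FundGroup v := x

theorem toFundGroup_mul {v : V} (x y : Γ.HomotopyClass v v) :
    toFundGroup x * toFundGroup y = toFundGroup (x.trans y) := rfl

/-- The group element defined by a homotopy class of paths, given a marking and paths `t` from
the base point to all vertices. -/
def coord {u w : V} (x : Γ.HomotopyClass u w) : F :=
  α.symm (toFundGroup ((t u).trans (x.trans (t w).symm)))

theorem coord_trans {u w y : V} (a : Γ.HomotopyClass u w) (b : Γ.HomotopyClass w y) :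
    coord α t (a.trans b) = coord α t a * coord α t b := by
  unfold coord
  rw [← map_mul, toFundGroup_mul]
  congr 2
  simp only [HomotopyClass.trans_assoc, HomotopyClass.symm_trans_trans]

theorem coord_mk_nil (u : V) : coord α t (HomotopyClass.mk (Γ := Γ) (u := u) [] rfl) = 1 := by
  have hnil : Γ.IsPath u [] u := rfl
  exact left_eq_mul.1 (coord_trans α t (HomotopyClass.mk [] hnil) (HomotopyClass.mk [] hnil))

theorem coord_symm {u w : V} (a : Γ.HomotopyClass u w) :
    coord α t a.symm = (coord α t a)⁻¹ := by
  refine eq_inv_of_mul_eq_one_left ?_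
  rw [← coord_trans, ← coord_mk_nil α t w]
  congr 1
  have hnil : Γ.IsPath w [] w := rfl
  have h := HomotopyClass.symm_trans_trans a (HomotopyClass.mk [] hnil)
  obtain ⟨p, hp, rfl⟩ := a.exists_mk
  rw [HomotopyClass.mk_trans_mk, HomotopyClass.mk_congr (List.append_nil p)] at h
  exact h

theorem coord_injective {u w : V} :
    Function.Injective (coord α t : Γ.HomotopyClass u w → F) := by
  intro a b h
  have h' : (t u).trans (a.trans (t w).symm) = (t u).trans (b.trans (t w).symm) :=
    α.symm.injective h
  have h2 := congrArg (fun x => (t u).symm.trans x) h'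
  simp only [HomotopyClass.symm_trans_trans] at h2
  exact HomotopyClass.trans_right_cancel h2

theorem coord_surjective (u w : V) :
    Function.Surjective (coord α t : Γ.HomotopyClass u w → F) := by
  intro g
  let x : Γ.HomotopyClass v v := id (α g)
  refine ⟨(t u).symm.trans (x.trans (t w)), ?_⟩
  have : (t u).trans (((t u).symm.trans (x.trans (t w))).trans (t w).symm) = x := by
    rw [HomotopyClass.trans_assoc, HomotopyClass.trans_symm_trans_left,
      HomotopyClass.trans_trans_symm]
  unfold coord
  rw [this]
  exact α.symm_apply_apply g

/-- The label of an edge. -/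
def edgeLabel (e : E) : F :=
  coord α t (HomotopyClass.mk [e] (GraphSelfMap.isPath_singleton e))

theorem pathLabel_edgeLabel {u w : V} {p : List E} (hp : Γ.IsPath u p w) :
    pathLabel (edgeLabel α t) p = coord α t (HomotopyClass.mk p hp) := by
  induction p generalizing u with
  | nil => cases hp; exact (coord_mk_nil α t _).symm
  | cons e p ih =>
    obtain ⟨rfl, hp'⟩ := hp
    rw [pathLabel_cons, ih hp', edgeLabel, ← coord_trans, HomotopyClass.mk_trans_mk]
    rfl

theorem edgeLabel_rev (e : E) : edgeLabel α t (Γ.rev e) = (edgeLabel α t e)⁻¹ := by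
  have h : Γ.IsPath (Γ.tgt e) [Γ.rev e] (Γ.src e) :=
    IsPath.rev Γ (GraphSelfMap.isPath_singleton e)
  rw [← pathLabel_singleton (edgeLabel α t) (Γ.rev e), pathLabel_edgeLabel α t h, edgeLabel,
    ← coord_symm]
  rfl

theorem exists_path_label_eq (u w : V) (h : F) :
    ∃ p, Γ.IsPath u p w ∧ pathLabel (edgeLabel α t) p = h := by
  obtain ⟨x, rfl⟩ := coord_surjective α t u w h
  obtain ⟨p, hp, rfl⟩ := x.exists_mk
  exact ⟨p, hp, pathLabel_edgeLabel α t hp⟩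

theorem eq_of_pathLabel_eq {u w : V} {p q : List E} (hpr : Γ.IsReduced p)
    (hqr : Γ.IsReduced q) (hp : Γ.IsPath u p w) (hq : Γ.IsPath u q w)
    (h : pathLabel (edgeLabel α t) p = pathLabel (edgeLabel α t) q) : p = q := by
  rw [pathLabel_edgeLabel α t hp, pathLabel_edgeLabel α t hq] at h
  exact HomotopyClass.eq_of_mk_eq_mk (coord_injective α t h) hpr hqr

theorem exists_map_pathLabel_eq (f : GraphSelfMap Γ) (φ : Monoid.End F)
    (c : Γ.HomotopyClass v (f.onV v))
    (hc : ∀ x : F, f.mapClass (α x) = c.symm.trans (HomotopyClass.trans (α (φ x)) c)) :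
    ∃ d : V → F, ∀ u w p, Γ.IsPath u p w → φ (pathLabel (edgeLabel α t) p) =
      d u * pathLabel (edgeLabel α t) (f.mapPath p) * (d w)⁻¹ := by
  -- `D u` compares the two ways from the base point to `f u`: the image under `f` of the chosen
  -- path to `u`, preceded by `c`, and the path chosen for `f u`.
  let D (u : V) : Γ.HomotopyClass v v := c.trans ((f.mapClass (t u)).trans (t (f.onV u)).symm)
  refine ⟨fun u => α.symm (toFundGroup (D u)), fun u w p hp => ?_⟩
  rw [eq_mul_inv_iff_mul_eq, pathLabel_edgeLabel α t hp,
    pathLabel_edgeLabel α t (f.isPath_mapPath hp)]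
  set a := HomotopyClass.mk p hp
  have ha : HomotopyClass.mk _ (f.isPath_mapPath hp) = f.mapClass a := rfl
  rw [ha]
  let x : Γ.HomotopyClass v v := (t u).trans (a.trans (t w).symm)
  have hx : α (coord α t a) = toFundGroup x := α.apply_symm_apply _
  obtain ⟨y, hy⟩ : ∃ y : Γ.HomotopyClass v v, α (φ (coord α t a)) = toFundGroup y := ⟨_, rfl⟩
  have h1 : f.mapClass x = c.symm.trans (y.trans c) := by
    have := hc (coord α t a)
    rw [hx, hy] at this
    exact this
  have h2 : y = c.trans ((f.mapClass x).trans c.symm) := by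
    rw [h1, HomotopyClass.trans_assoc, HomotopyClass.trans_trans_symm,
      HomotopyClass.trans_symm_trans_left]
  apply α.injective
  rw [map_mul, map_mul, hy, coord, α.apply_symm_apply, α.apply_symm_apply, α.apply_symm_apply,
    toFundGroup_mul, toFundGroup_mul, h2]
  congr 1
  simp only [D, x, HomotopyClass.mapClass_trans, HomotopyClass.mapClass_symm,
    HomotopyClass.trans_assoc, HomotopyClass.symm_trans_trans]

end Coordinates

/-- A finitely generated subgroup has a finite core: a finite set of edges of the covering that
contains all reduced closed paths at the base point. -/
theorem exists_finite_core {F : Type*} [Group F] {l : E → F}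
    (hl : ∀ e, l (Γ.rev e) = (l e)⁻¹) {v : V}
    (hsurj : ∀ h : F, ∃ p, Γ.IsPath v p v ∧ pathLabel l p = h)
    (hinj : ∀ p q, Γ.IsReduced p → Γ.IsReduced q → Γ.IsPath v p v → Γ.IsPath v q v →
      pathLabel l p = pathLabel l q → p = q) {H : Subgroup F} (hfg : H.FG) :
    ∃ C : Set (E × (F ⧸ H)), C.Finite ∧ (∀ a ∈ C, (Γ.cover (F ⧸ H) hl).rev a ∈ C) ∧
      ∀ P, (Γ.cover (F ⧸ H) hl).IsPath (v, ((1 : F) : F ⧸ H)) P (v, ((1 : F) : F ⧸ H)) →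
        (Γ.cover (F ⧸ H) hl).IsReduced P → ∀ a ∈ P, a ∈ C := by
  set Δ := Γ.cover (F ⧸ H) hl
  set x₀ : F ⧸ H := ((1 : F) : F ⧸ H)
  have hsmul (h : F) : h⁻¹ • x₀ = x₀ ↔ h ∈ H := by
    change ((h⁻¹ * 1 : F) : F ⧸ H) = ((1 : F) : F ⧸ H) ↔ h ∈ H
    rw [QuotientGroup.eq]
    simp
  obtain ⟨S, hS⟩ := hfg
  choose r hr hrl using hsurj
  let C₀ : Set (E × (F ⧸ H)) := ⋃ g ∈ S, {a | a ∈ pathLift l x₀ (r g)}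
  have hC₀ : C₀.Finite := S.finite_toSet.biUnion fun g _ => List.finite_toSet _
  let C := C₀ ∪ Δ.rev '' C₀
  have hrev : ∀ a ∈ C, Δ.rev a ∈ C := by
    rintro a (ha | ⟨b, hb, rfl⟩)
    · exact Or.inr ⟨a, ha, rfl⟩
    · rw [Δ.rev_rev]
      exact Or.inl hb
  refine ⟨C, hC₀.union (hC₀.image _), hrev, ?_⟩
  -- Loops for generators lift to closed paths in `C`; products and inverses stay in `C`, though
  -- they need not be reduced.
  have key : ∀ h ∈ H, ∃ q, Γ.IsPath v q v ∧ pathLabel l q = h ∧ ∀ a ∈ pathLift l x₀ q, a ∈ C := by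
    intro h hh
    rw [← hS] at hh
    induction hh using Subgroup.closure_induction with
    | mem g hg =>
      exact ⟨r g, hr g, hrl g, fun a ha => Or.inl (Set.mem_biUnion (by simpa using hg) ha)⟩
    | one => exact ⟨[], rfl, rfl, by simp [pathLift]⟩
    | mul g h hg _ ihg ihh =>
      obtain ⟨p, hp, rfl, hpC⟩ := ihg
      obtain ⟨q, hq, rfl, hqC⟩ := ihh
      refine ⟨p ++ q, IsPath.append Γ hp hq, pathLabel_append l p q, fun a ha => ?_⟩
      rw [pathLift_append, (hsmul _).2 (hS ▸ hg), List.mem_append] at ha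
      exact ha.elim (hpC a) (hqC a)
    | inv g hg ih =>
      obtain ⟨p, hp, rfl, hpC⟩ := ih
      refine ⟨Γ.revPath p, IsPath.rev Γ hp, Γ.pathLabel_revPath hl p, fun a ha => ?_⟩
      have h1 := Γ.revPath_pathLift hl p x₀
      rw [(hsmul _).2 (hS ▸ hg)] at h1
      rw [← h1] at ha
      simp only [revPath, List.mem_reverse, List.mem_map] at ha
      obtain ⟨b, hb, rfl⟩ := ha
      exact hrev b (hpC b hb)
  intro P hP hPr a ha
  obtain ⟨h1, h2, h3⟩ := Γ.exists_eq_pathLift hl hP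
  obtain ⟨q, hq, hql, hqC⟩ := key (pathLabel l (P.map Prod.fst)) ((hsmul _).1 h3.symm)
  have hQ := Γ.isPath_pathLift hl hq x₀
  rw [hql, ← h3] at hQ
  obtain ⟨h4, h5, -⟩ := Γ.exists_eq_pathLift hl hQ.reduce
  have hlab : pathLabel l ((Δ.reduce (pathLift l x₀ q)).map Prod.fst) = pathLabel l q := by
    have := Δ.pathLabel_reduce (l := fun c => l c.1) (fun c => hl c.1) (pathLift l x₀ q)
    conv_rhs => rw [← map_fst_pathLift l x₀ q]
    simpa [pathLabel, Function.comp_def] using this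
  -- A reduced loop is determined by its label, so `P` is the reduction of the loop from `key`;
  -- reducing only deletes edges.
  have heq := hinj _ _ ((Γ.isReduced_pathLift_iff hl _ _).1 (h2 ▸ hPr))
    ((Γ.isReduced_pathLift_iff hl _ _).1 (h5 ▸ Δ.isReduced_reduce _)) h1 h4
    (hql.symm.trans hlab.symm)
  refine hqC a ((Δ.reduce_sublist _).subset ?_)
  rw [h5, ← heq, ← h2]
  exact ha

end Groupoid

end OrientedGraph

/-! ### The induced map on cosets and the theorem -/

section Cosets

variable {F : Type*} [Group F] {H : Subgroup F} (φ : Monoid.End F)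

/-- The map induced on left cosets of `H` by an endomorphism that maps `H` into itself. -/
def cosetMap (hinv : H.map φ ≤ H) : F ⧸ H → F ⧸ H :=
  Quotient.map' φ (by
    intro a b hab
    rw [QuotientGroup.leftRel_apply] at hab ⊢
    rw [← map_inv, ← map_mul]
    exact hinv (Subgroup.mem_map_of_mem φ hab))

variable {φ} (hinv : H.map φ ≤ H)

theorem cosetMap_mk (g : F) : cosetMap φ hinv (g : F ⧸ H) = ((φ g : F) : F ⧸ H) := rfl

theorem cosetMap_smul (g : F) (x : F ⧸ H) :
    cosetMap φ hinv (g • x) = φ g • cosetMap φ hinv x := by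
  induction x using QuotientGroup.induction_on with
  | H a =>
    change ((φ (g * a) : F) : F ⧸ H) = ((φ g * φ a : F) : F ⧸ H)
    rw [map_mul]

theorem cosetMap_iterate_mk (n : ℕ) (g : F) :
    (cosetMap φ hinv)^[n] (g : F ⧸ H) = (((φ ^ n) g : F) : F ⧸ H) := by
  induction n generalizing g with
  | zero => rfl
  | succ n ih =>
    rw [Function.iterate_succ_apply, cosetMap_mk, ih, pow_succ]
    rfl

theorem cosetMap_iterate_smul (n : ℕ) (g : F) (x : F ⧸ H) :
    (cosetMap φ hinv)^[n] (g • x) = (φ ^ n) g • (cosetMap φ hinv)^[n] x := by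
  induction x using QuotientGroup.induction_on with
  | H a =>
    change (cosetMap φ hinv)^[n] ((g * a : F) : F ⧸ H) = _
    rw [cosetMap_iterate_mk, cosetMap_iterate_mk, map_mul]
    rfl

/-- Translations can be moved past the coset map, so the lift of `f ^ n` and the map induced by `φ ^
n` have images that are translates of each other on each fibre. -/
theorem exists_fibreIter_eq_smul {V E : Type*} {Γ : OrientedGraph V E} (f : GraphSelfMap Γ)
    (d : V → F) (n : ℕ) (u : V) : ∃ a : F, ∀ x,
      f.fibreIter (fun u x => (d u)⁻¹ • cosetMap φ hinv x) n u x =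
        a • (cosetMap φ hinv)^[n] x := by
  induction n generalizing u with
  | zero => exact ⟨1, fun x => (one_smul F x).symm⟩
  | succ n ih =>
    obtain ⟨a, ha⟩ := ih (f.onV u)
    refine ⟨a * (φ ^ n) (d u)⁻¹, fun x => ?_⟩
    change f.fibreIter _ n (f.onV u) ((d u)⁻¹ • cosetMap φ hinv x) = _
    rw [ha, cosetMap_iterate_smul, ← mul_smul, Function.iterate_succ_apply]

/-- A subgroup `R` meets `H` in a subgroup of finite index if it meets only finitely many cosets
of `H`. -/
theorem Subgroup.finiteIndex_inf_subgroupOf {F : Type*} [Group F] {R H : Subgroup F}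
    (h : ((fun g : F => (g : F ⧸ H)) '' R).Finite) : ((R ⊓ H).subgroupOf R).FiniteIndex := by
  have : Finite ((fun g : F => (g : F ⧸ H)) '' R) := h
  let j : R ⧸ (R ⊓ H).subgroupOf R → (fun g : F => (g : F ⧸ H)) '' R :=
    fun q => ⟨((Quotient.out q : R) : F), _, (Quotient.out q).2, rfl⟩
  have hj : Function.Injective j := by
    intro a b hab
    have h1 := QuotientGroup.eq.1 (congrArg Subtype.val hab)
    rw [← QuotientGroup.out_eq' a, ← QuotientGroup.out_eq' b, QuotientGroup.eq,
      Subgroup.mem_subgroupOf]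
    exact ⟨((Quotient.out a)⁻¹ * Quotient.out b).2, h1⟩
  have := Finite.of_injective j hj
  exact Subgroup.finiteIndex_of_finite_quotient

end Cosets

/-- Paths whose labels lie in the images of an expanding conjugacy class get long. -/
theorem IsExpandingConjClass.exists_lt_length {ι F E : Type*} [Group F] [Finite E]
    {b : FreeGroupBasis ι F} {φ : Monoid.End F} {h : F}
    (hexp : IsExpandingConjClass b φ (ConjClasses.mk h)) (l : E → F) (L : ℕ) :
    ∃ k, ∀ q : List E, IsConj (pathLabel l q) ((φ ^ k) h) → L < q.length := by
  -- There are finitely many lists of length at most `L` over the finite set `E`, so their classes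
  -- have bounded length.
  obtain ⟨B, hB⟩ := ((List.finite_length_le E L).image
    fun q => conjClassLength b (ConjClasses.mk (pathLabel l q))).bddAbove
  obtain ⟨k, hk⟩ := hexp (B + 1)
  refine ⟨k, fun q hq => ?_⟩
  by_contra! hL
  have h1 := hB ⟨q, hL, rfl⟩
  have h2 : ConjClasses.map (φ ^ k) (ConjClasses.mk h) = ConjClasses.mk (pathLabel l q) :=
    (ConjClasses.mk_eq_mk_iff_isConj.2 hq).symm
  rw [h2] at hk
  simp only at h1
  omega

/-- For a closed path the two correction factors in `hd` are `d u` and its inverse, so each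
application of `f` costs one conjugation. -/
theorem GraphSelfMap.isConj_pathLabel_mapPath_iterate {V E F : Type*} [Group F]
    {Γ : OrientedGraph V E} {f : GraphSelfMap Γ} {φ : Monoid.End F} {l : E → F} {d : V → F}
    (hd : ∀ u w p, Γ.IsPath u p w →
      φ (pathLabel l p) = d u * pathLabel l (f.mapPath p) * (d w)⁻¹)
    (k : ℕ) {u : V} {p : List E} (hp : Γ.IsPath u p u) :
    IsConj (pathLabel l (f.mapPath^[k] p)) ((φ ^ k) (pathLabel l p)) := by
  induction k generalizing u p with
  | zero => exact IsConj.refl _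
  | succ k ih =>
    refine (ih (f.isPath_mapPath hp)).trans ?_
    rw [pow_succ]
    refine MonoidHom.map_isConj (φ ^ k : Monoid.End F) ?_
    exact isConj_iff.2 ⟨d u, (hd u u p hp).symm⟩

theorem mainTheorem4 {ι F : Type*} [Finite ι] [Nontrivial ι] [Group F] (b : FreeGroupBasis ι F)
    (φ : Monoid.End F) (hφ : Function.Injective φ)
    {V E : Type*} [Finite V] [Finite E] {Γ : OrientedGraph V E} (f : GraphSelfMap Γ)
    (hclean : f.IsClean) (hrep : f.IsRepresentative φ)
    (H : Subgroup F) (hfg : H.FG) (hinv : H.map φ ≤ H)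
    (hexp : ∃ h ∈ H, IsExpandingConjClass b φ (ConjClasses.mk h)) :
    ∃ k : ℕ, (((MonoidHom.range (φ ^ k)) ⊓ H).subgroupOf (MonoidHom.range (φ ^ k))).FiniteIndex := by
  obtain ⟨hconn, -, -, v, α, c, hc⟩ := hrep
  obtain ⟨h, hh, hexp⟩ := hexp
  have ht : ∀ u, Nonempty (Γ.HomotopyClass v u) := fun u =>
    let ⟨p, hp⟩ := hconn v u
    ⟨.mk p hp⟩
  let t : ∀ u, Γ.HomotopyClass v u := fun u => (ht u).some
  set l : E → F := OrientedGraph.edgeLabel α t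
  have hl : ∀ e, l (Γ.rev e) = (l e)⁻¹ := OrientedGraph.edgeLabel_rev α t
  obtain ⟨d, hd⟩ := OrientedGraph.exists_map_pathLabel_eq α t f φ c hc
  -- The factor `(d u)⁻¹` absorbs the discrepancy between `φ` and `f` on labels of non-closed paths,
  -- making the coset map compatible with transport.
  have hg : f.IsFibreMap l fun u x => (d u)⁻¹ • cosetMap φ hinv x := by
    intro e x
    have h1 := hd _ _ _ (GraphSelfMap.isPath_singleton e)
    rw [pathLabel_singleton, eq_mul_inv_iff_mul_eq] at h1
    have h2 : f.mapPath [e] = f.onE e := by simp [GraphSelfMap.mapPath]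
    rw [h2] at h1
    beta_reduce
    rw [cosetMap_smul, ← mul_smul, ← mul_smul, map_inv, ← mul_inv_rev, ← mul_inv_rev, h1]
  have hlab := OrientedGraph.exists_path_label_eq α t
  have htrans : ∀ u w (x y : F ⧸ H), ∃ p, Γ.IsPath u p w ∧ (pathLabel l p)⁻¹ • x = y := by
    intro u w x y
    obtain ⟨a, rfl⟩ := MulAction.exists_smul_eq F x y
    obtain ⟨p, hp, hpl⟩ := hlab u w a⁻¹
    exact ⟨p, hp, by rw [hpl, inv_inv]⟩
  have hred : ∀ n e, Γ.IsReduced (f.iter n e) := by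
    intro n e
    rcases n with _ | n
    · exact List.isChain_singleton e
    · exact ((hclean.isTrainTrack.2.2 (n + 1) (by omega)).1 e).2
  obtain ⟨C, hCfin, hCrev, hC⟩ := OrientedGraph.exists_finite_core hl (hlab v v)
    (fun p q hp hq hp' hq' => OrientedGraph.eq_of_pathLabel_eq α t hp hq hp' hq') hfg
  obtain ⟨p, hp, hpl⟩ := hlab v v h
  have hne := hg.exists_liftStarts_nonempty hl htrans hred hC hp
    (by
      rw [hpl]
      change ((h⁻¹ * 1 : F) : F ⧸ H) = ((1 : F) : F ⧸ H)
      rw [QuotientGroup.eq]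
      simpa using hh)
    (fun L => by
      obtain ⟨k, hk⟩ := hexp.exists_lt_length l L
      refine ⟨k, fun q hq => hk q (hq.trans ?_)⟩
      have := GraphSelfMap.isConj_pathLabel_mapPath_iterate hd k hp
      rwa [hpl] at this)
  obtain ⟨n, T, hT, hTn⟩ := hg.exists_finite_range hclean hl htrans hCfin hCrev hne
  refine ⟨n, Subgroup.finiteIndex_inf_subgroupOf ?_⟩
  obtain ⟨a, ha⟩ := exists_fibreIter_eq_smul hinv f d n v
  -- Undoing the translation `a` over `v` places all cosets of elements of the range of `φ ^ n` in a
  -- translate of `T`.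
  refine (hT.image (a⁻¹ • ·)).subset ?_
  rintro - ⟨-, ⟨g, rfl⟩, rfl⟩
  refine ⟨_, hTn v ((g : F) : F ⧸ H), ?_⟩
  change a⁻¹ • f.fibreIter _ n v _ = _
  rw [ha, inv_smul_smul, cosetMap_iterate_mk]
  rfl
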